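/- **Setting.** Let $\mathsf S^4=(\mathbb R^5\smallsetminus\{0\})/\mathbb R_{>0}$ be the projective sphere, with the quotient topology and points $[x]=[x_0:\dots:x_4]$, and let $\mathsf A^4=\{[x]\mid x_0>0\}$. For $\alpha\in\mathbb R^5\smallsetminus\{0\}$, the half-space $(\alpha)=(\alpha_0:\dots:\alpha_4)$ is $\{[x]\mid \sum_i\alpha_ix_i\le 0\}$ and its boundary is the hyperplane $\{[x]\mid \sum_i\alpha_ix_i=0\}$. A *4-polytope* in $\mathsf S^4$ is a finite intersection of half-spaces with non-empty interior. Its *faces* are the polytope itself and its non-empty intersections with the boundary of a half-space containing it; its *vertices* are the points $v$ such that $\{v\}$ is a face; its *combinatorics* is the isomorphism class of the poset of its faces, ordered by inclusion. For $t\in\mathbb R$ let $q_t(x)=-x_0^2+x_1^2+x_2^2+x_3^2+\operatorname{sign}(t)\,t^2x_4^2$, and let $$\mathbb X^4_t=\{[x]\mid q_t(x)<0,\ x_0>0\}\ (t>0),\qquad \mathbb X^4_0=\{[x]\mid q_0(x)<0,\ x_0\ge0\},\qquad \mathbb X^4_t=\{[x]\mid q_t(x)<0\}\ (t<0),$$ with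 topological closure $\overline{\mathbb X^4_t}$ and frontier $\partial\mathbb X^4_t$ in $\mathsf S^4$. For $s>0$ let $\mathfrak r_s[x_0:x_1:x_2:x_3:x_4]=[x_0:x_1:x_2:x_3:x_4/s]$. Let $E=\{\pm1\}^3$, and for $\epsilon=(\epsilon_1,\epsilon_2,\epsilon_3)\in E$ put $\eta=\epsilon_1\epsilon_2\epsilon_3$. Let $\overline{\mathcal P}_t\subset\mathsf S^4$ be the intersection of the 22 half-spaces $$(-\sqrt2\,|t|:\epsilon_1|t|:\epsilon_2|t|:\epsilon_3|t|:\eta),\qquad (-\sqrt2:\epsilon_1:\epsilon_2:\epsilon_3:-\eta t)\qquad(\epsilon\in E),$$ $$(-1:\pm\sqrt2:0:0:0),\quad(-1:0:\pm\sqrt2:0:0),\quad(-1:0:0:\pm\sqrt2:0).$$ For $t\ne0$ consider the rescaled set $\mathfrak r_{|t|}(\overline{\mathcal P}_t)$. For $t=0$ the symbol $\mathfrak r_{|t|}(\overline{\mathcal P}_t)$ denotes, by definition, the intersection of the 22 half-spaces listed in (1) below with $t=0$. **Proposition.** For every $t\in I=(-1,\tfrac1{\sqrt3}]$: 1. $\mathfrak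 r_{|t|}(\overline{\mathcal P}_t)$ is the intersection of the 22 half-spaces $$(-\sqrt2:\epsilon_1:\epsilon_2:\epsilon_3:\eta),\qquad(-\sqrt2:\epsilon_1:\epsilon_2:\epsilon_3:-\eta\,t|t|)\qquad(\epsilon\in E),$$ $$(-1:\pm\sqrt2:0:0:0),\quad(-1:0:\pm\sqrt2:0:0),\quad(-1:0:0:\pm\sqrt2:0),$$ none of which contains the intersection of the other 21. 2. $\mathfrak r_{|t|}(\overline{\mathcal P}_t)$ is a 4-polytope, and $\mathfrak r_{|t|}(\overline{\mathcal P}_t)\subset\overline{\mathbb X^4_t}\cap\mathsf A^4$. 3. $\mathfrak r_{|t|}(\overline{\mathcal P}_t)$ has exactly 46 vertices, of which 12 are ideal (they lie in $\partial\mathbb X^4_t$) and the other 34 lie in $\mathbb X^4_t$. Moreover, the combinatorics of $\mathfrak r_{|t|}(\overline{\mathcal P}_t)$ does not depend on $t\in I$, and $\mathfrak r_{|t|}(\overline{\mathcal P}_t)$ converges to the polytope at $t=0$ as $t\to0$, in the Hausdorff topology on closed subsets of $\mathsf S^4$. -/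

import Mathlib

open Set Filter Topology

noncomputable section

namespace TransitionPolytope

/-- The vector space `ℝ⁵`, with coordinates `x 0, …, x 4`. -/
abbrev V : Type := Fin 5 → ℝ

/-- The projective sphere `S⁴ = (ℝ⁵ ∖ {0}) / ℝ_{>0}`. -/
abbrev S4 : Type := Module.Ray ℝ V

/-- The class `[x] ∈ S⁴` of a nonzero vector `x`. -/
def cls (x : {x : V // x ≠ 0}) : S4 := rayOfNeZero ℝ x.1 x.2

/-- The quotient topology on `S⁴`. -/
instance : TopologicalSpace S4 := TopologicalSpace.coinduced cls inferInstance

/-- The set `{[x] ∈ S⁴ | p x}`. It is only used for conditions `p` that are invariant under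
multiplication of `x` by positive numbers. -/
def projSet (p : V → Prop) : Set S4 := cls '' {x | p x.1}

/-- The affine chart `A⁴ = {[x] | x₀ > 0}`. -/
def affineChart : Set S4 := projSet fun x => 0 < x 0

/-- The quadratic form `q_t(x) = -x₀² + x₁² + x₂² + x₃² + sign(t) t² x₄²`. -/
def q (t : ℝ) (x : V) : ℝ :=
  -(x 0) ^ 2 + (x 1) ^ 2 + (x 2) ^ 2 + (x 3) ^ 2 + Real.sign t * t ^ 2 * (x 4) ^ 2

/-- The domain `X⁴_t`: a rescaled copy of hyperbolic space for `t > 0`, half-pipe space for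
`t = 0`, a rescaled copy of (the double cover in `S⁴` of) Anti-de Sitter space for `t < 0`. -/
def X (t : ℝ) : Set S4 :=
  if 0 < t then projSet fun x => q t x < 0 ∧ 0 < x 0
  else if t = 0 then projSet fun x => q 0 x < 0 ∧ 0 ≤ x 0
  else projSet fun x => q t x < 0

/-- The value at `x` of the linear form with coordinates `α`. -/
def pairing (α x : V) : ℝ := ∑ i, α i * x i

/-- The half-space `(α) = {[x] | α(x) ≤ 0}` of `S⁴`, for `α ≠ 0`. -/
def halfSpace (α : V) : Set S4 := projSet fun x => pairing α x ≤ 0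

/-- The hyperplane `∂(α) = {[x] | α(x) = 0}` of `S⁴`, for `α ≠ 0`. -/
def hyperplane (α : V) : Set S4 := projSet fun x => pairing α x = 0

/-- A projective 4-polytope: a finite intersection of half-spaces of `S⁴`, with non-empty
interior. -/
def IsPolytope (P : Set S4) : Prop :=
  (∃ s : Finset V, (∀ α ∈ s, α ≠ 0) ∧ P = ⋂ α ∈ s, halfSpace α) ∧ (interior P).Nonempty

/-- The (non-empty) faces of a polytope `P`: `P` itself, and the non-empty intersections of `P`
with the boundary of a half-space that contains `P`. -/
def IsFace (P F : Set S4) : Prop :=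
  F.Nonempty ∧ (F = P ∨ ∃ α : V, α ≠ 0 ∧ P ⊆ halfSpace α ∧ F = P ∩ hyperplane α)

/-- The poset of faces, ordered by inclusion. -/
abbrev Faces (P : Set S4) : Type := {F : Set S4 // IsFace P F}

/-- Two polytopes have the same combinatorics if their posets of faces are isomorphic. -/
def SameCombinatorics (P Q : Set S4) : Prop := Nonempty (Faces P ≃o Faces Q)

/-- The set of vertices of `P`, that is, the points `v` such that `{v}` is a face. -/
def vertices (P : Set S4) : Set S4 := {v | IsFace P {v}}

/-- The projective transformation `r_s = [diag(1, 1, 1, 1, 1/s)]` of `S⁴`, for `s ≠ 0`. -/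
def rescale (s : ℝ) (hs : s ≠ 0) : S4 → S4 :=
  Module.Ray.map (LinearEquiv.piCongrRight fun i : Fin 5 =>
    if i = 4 then LinearEquiv.smulOfNeZero ℝ ℝ s⁻¹ (inv_ne_zero hs) else LinearEquiv.refl ℝ ℝ)

/-- Index set of the 22 half-spaces: `0⁺, …, 7⁺`, then `0⁻, …, 7⁻`, then `A, …, F`. -/
abbrev Idx : Type := Fin 8 ⊕ Fin 8 ⊕ Fin 6

/-- The linear forms `A, …, F`. -/
def wallLetter : Fin 6 → V :=
  ![![-1, √2, 0, 0, 0],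
    ![-1, 0, √2, 0, 0],
    ![-1, 0, 0, √2, 0],
    ![-1, 0, 0, -√2, 0],
    ![-1, 0, -√2, 0, 0],
    ![-1, -√2, 0, 0, 0]]

/-- The linear forms `0⁺, …, 7⁺` at time `t`. -/
def wallPlus (t : ℝ) : Fin 8 → V :=
  ![![-√2 * |t|,  |t|,  |t|,  |t|,  1],
    ![-√2 * |t|,  |t|, -|t|,  |t|, -1],
    ![-√2 * |t|,  |t|, -|t|, -|t|,  1],
    ![-√2 * |t|,  |t|,  |t|, -|t|, -1],
    ![-√2 * |t|, -|t|,  |t|, -|t|,  1],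
    ![-√2 * |t|, -|t|,  |t|,  |t|, -1],
    ![-√2 * |t|, -|t|, -|t|,  |t|,  1],
    ![-√2 * |t|, -|t|, -|t|, -|t|, -1]]

/-- The linear forms `0⁻, …, 7⁻` at time `t`. -/
def wallMinus (t : ℝ) : Fin 8 → V :=
  ![![-√2,  1,  1,  1, -t],
    ![-√2,  1, -1,  1,  t],
    ![-√2,  1, -1, -1, -t],
    ![-√2,  1,  1, -1,  t],
    ![-√2, -1,  1, -1, -t],
    ![-√2, -1,  1,  1,  t],
    ![-√2, -1, -1,  1, -t],
    ![-√2, -1, -1, -1,  t]]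

/-- The 22 linear forms at time `t`. -/
def wall (t : ℝ) : Idx → V := Sum.elim (wallPlus t) (Sum.elim (wallMinus t) wallLetter)

/-- The set `P̄_t`, the intersection of the 22 half-spaces at time `t`. -/
def Pbar (t : ℝ) : Set S4 := ⋂ i, halfSpace (wall t i)

/-- The rescaled linear forms `r_{|t|} 0⁺, …, r_{|t|} 7⁺`, which do not depend on `t`. -/
def rescaledPlus : Fin 8 → V :=
  ![![-√2,  1,  1,  1,  1],
    ![-√2,  1, -1,  1, -1],
    ![-√2,  1, -1, -1,  1],
    ![-√2,  1,  1, -1, -1],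
    ![-√2, -1,  1, -1,  1],
    ![-√2, -1,  1,  1, -1],
    ![-√2, -1, -1,  1,  1],
    ![-√2, -1, -1, -1, -1]]

/-- The rescaled linear forms `r_{|t|} 0⁻, …, r_{|t|} 7⁻`. -/
def rescaledMinus (t : ℝ) : Fin 8 → V :=
  ![![-√2,  1,  1,  1, -(t * |t|)],
    ![-√2,  1, -1,  1,  t * |t|],
    ![-√2,  1, -1, -1, -(t * |t|)],
    ![-√2,  1,  1, -1,  t * |t|],
    ![-√2, -1,  1, -1, -(t * |t|)],
    ![-√2, -1,  1,  1,  t * |t|],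
    ![-√2, -1, -1,  1, -(t * |t|)],
    ![-√2, -1, -1, -1,  t * |t|]]

/-- The 22 rescaled linear forms, defined for all `t`, including `t = 0`. -/
def rescaledWall (t : ℝ) : Idx → V :=
  Sum.elim rescaledPlus (Sum.elim (rescaledMinus t) wallLetter)

/-- The rescaled polytope: `r_{|t|}(P̄_t)` for `t ≠ 0`, extended to `t = 0` by the limits of the
22 rescaled half-spaces. -/
def rescaledPbar (t : ℝ) : Set S4 :=
  if h : t = 0 then ⋂ i, halfSpace (rescaledWall 0 i)
  else rescale |t| (abs_ne_zero.mpr h) '' Pbar t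

/-- Convergence of the sets `K t` to the compact set `K 0` as `t → 0`, `t ≠ 0`, in the Hausdorff
(Vietoris) topology. -/
def ConvergesAtZero (K : ℝ → Set S4) : Prop :=
  (∀ U : Set S4, IsOpen U → K 0 ⊆ U → ∀ᶠ t in 𝓝[≠] (0 : ℝ), K t ⊆ U) ∧
  ∀ U : Set S4, IsOpen U → (K 0 ∩ U).Nonempty → ∀ᶠ t in 𝓝[≠] (0 : ℝ), (K t ∩ U).Nonempty

end TransitionPolytope

end

noncomputable section

namespace TransitionPolytope

/-! ### The projective sphere -/

/-! After rescaling, `t` enters the 22 linear forms only through `s = t|t|`, and `t ∈ (-1, 1/√3]`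
gives `-1 < s ≤ 1/3`. Writing `x₀ = √2 h` removes the square roots up to positive factors
(`exists_pairing_eq`), so everything becomes polynomial in `s` and the coordinates `(h; a, b, c;
w)`.

The core is that the cone cut out by the 22 forms is generated by 46 explicit vectors `vert s k`. By
`exists_sum_of_exists_tight` it suffices that every nonzero point of the cone has one of these
vectors in its smallest face: one then subtracts the largest admissible multiple of that vector,
which makes a further form vanish, and repeats. Signed permutations of `a, b, c` (a sign change also
reversing `w`) preserve the configuration, so such a vector is only needed for points with `0 ≤ c ≤
b ≤ a`, where a few cases remain (`exists_inc_of_chamber`).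

Each form takes on each generator a value that is identically zero in `s` or negative
(`value_nonpos_and_eq_zero_iff`). The incidence table `inc` is therefore the same for all `t`. The
face poset of a polytope whose cone has known generators depends only on this table
(`range_faceEmbedding`), whence the constancy of the combinatorics. No vertex lies on all the walls
through another one, so the 46 generators are exactly the vertices.

Containment in the closure of the domain is a quadratic inequality on the cone, `InCone.q_nonpos`,
again proved in the chamber. Irredundancy uses a point beyond each single wall. Convergence holds
for any finite family of continuously varying half-spaces whose limit cone has an interior point:
compactness of the unit sphere gives one half, the interior point the other. -/

theorem cls_surjective : Function.Surjective cls := fun r => by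
  induction r using Module.Ray.ind with
  | h v hv => exact ⟨⟨v, hv⟩, rfl⟩

theorem cls_eq_cls_iff {x y : {x : V // x ≠ 0}} :
    cls x = cls y ↔ ∃ c : ℝ, 0 < c ∧ c • x.1 = y.1 := by
  rw [cls, cls, ray_eq_iff]
  constructor
  · intro h
    exact (exists_pos_left_iff_sameRay x.2 y.2).2 h
  · intro h
    exact (exists_pos_left_iff_sameRay x.2 y.2).1 h

theorem cls_mem_projSet {p : V → Prop} (hp : ∀ x (c : ℝ), 0 < c → p x → p (c • x))
    (x : {x : V // x ≠ 0}) : cls x ∈ projSet p ↔ p x.1 := by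
  constructor
  · rintro ⟨y, hy, hyx⟩
    obtain ⟨c, hc, h⟩ := cls_eq_cls_iff.1 hyx
    rw [← h]
    exact hp _ _ hc hy
  · intro h
    exact ⟨x, h, rfl⟩

theorem continuous_cls : Continuous cls := continuous_coinduced_rng

theorem isOpen_projSet {p : V → Prop} (hp : ∀ x (c : ℝ), 0 < c → p x → p (c • x))
    (ho : IsOpen {x | p x}) : IsOpen (projSet p) := by
  rw [isOpen_coinduced]
  have : cls ⁻¹' projSet p = Subtype.val ⁻¹' {x | p x} := by
    ext x
    exact cls_mem_projSet hp x
  rw [this]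
  exact ho.preimage continuous_subtype_val

theorem pairing_add (α x y : V) : pairing α (x + y) = pairing α x + pairing α y := by
  simp [pairing, mul_add, Finset.sum_add_distrib]

theorem pairing_smul (α x : V) (c : ℝ) : pairing α (c • x) = c * pairing α x := by
  simp only [pairing, Finset.mul_sum, Pi.smul_apply, smul_eq_mul]
  exact Finset.sum_congr rfl fun i _ => by ring

theorem pairing_sub (α x y : V) : pairing α (x - y) = pairing α x - pairing α y := by
  simp [pairing, mul_sub, Finset.sum_sub_distrib]

theorem pairing_zero (α : V) : pairing α 0 = 0 := by simp [pairing]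

theorem zero_pairing (x : V) : pairing 0 x = 0 := by simp [pairing]

theorem pairing_sum {K : Type*} (s : Finset K) (α : V) (x : K → V) :
    pairing α (∑ k ∈ s, x k) = ∑ k ∈ s, pairing α (x k) := by
  simp only [pairing, Finset.sum_apply, Finset.mul_sum]
  exact Finset.sum_comm

theorem sum_pairing {I : Type*} (s : Finset I) (α : I → V) (x : V) :
    pairing (∑ i ∈ s, α i) x = ∑ i ∈ s, pairing (α i) x := by
  simp only [pairing, Finset.sum_apply, Finset.sum_mul]
  exact Finset.sum_comm

theorem continuous_pairing (α : V) : Continuous (pairing α) := by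
  unfold pairing
  fun_prop

theorem cls_mem_halfSpace {α : V} (x : {x : V // x ≠ 0}) :
    cls x ∈ halfSpace α ↔ pairing α x.1 ≤ 0 :=
  cls_mem_projSet (fun y c hc h => by
    rw [pairing_smul]; exact mul_nonpos_of_nonneg_of_nonpos hc.le h) x

theorem cls_mem_hyperplane {α : V} (x : {x : V // x ≠ 0}) :
    cls x ∈ hyperplane α ↔ pairing α x.1 = 0 :=
  cls_mem_projSet (fun y c hc h => by rw [pairing_smul, h, mul_zero]) x

/-! ### Polyhedral cones with given generators -/

section Cone

variable {I K : Type*} [Fintype K]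

/-- The cone of all vectors on which the linear forms `ℓ i` are nonpositive is generated by the
nonzero vectors `v k`, and has an interior point. -/
structure IsGeneratedBy (ℓ : I → V) (v : K → V) : Prop where
  ne_zero : ∀ k, v k ≠ 0
  nonpos : ∀ i k, pairing (ℓ i) (v k) ≤ 0
  exists_sum : ∀ x, (∀ i, pairing (ℓ i) x ≤ 0) → ∃ c : K → ℝ, (∀ k, 0 ≤ c k) ∧ x = ∑ k, c k • v k
  exists_neg : ∃ x, x ≠ 0 ∧ ∀ i, pairing (ℓ i) x < 0

/-- If, for every nonzero `x` in a polyhedral cone, some `v k` lies in the smallest face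
containing `x`, then the `v k` generate the cone. -/
theorem exists_sum_of_exists_tight [Fintype I] {ℓ : I → V} {v : K → V}
    (hneg : ∀ k, ∃ i, pairing (ℓ i) (v k) < 0) (hnonpos : ∀ i k, pairing (ℓ i) (v k) ≤ 0)
    (htight : ∀ x, x ≠ 0 → (∀ i, pairing (ℓ i) x ≤ 0) →
      ∃ k, ∀ i, pairing (ℓ i) x = 0 → pairing (ℓ i) (v k) = 0)
    (x : V) (hx : ∀ i, pairing (ℓ i) x ≤ 0) :
    ∃ c : K → ℝ, (∀ k, 0 ≤ c k) ∧ x = ∑ k, c k • v k := by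
  classical
  induction hn : (Finset.univ.filter fun i => pairing (ℓ i) x ≠ 0).card
    using Nat.strong_induction_on generalizing x with
  | _ n ih =>
    by_cases hx0 : x = 0
    · exact ⟨0, fun _ => le_rfl, by simp [hx0]⟩
    obtain ⟨k, hk⟩ := htight x hx0 hx
    obtain ⟨i₀, hi₀⟩ := hneg k
    -- The minimal ratio `r` is the largest multiple of `v k` that can be subtracted from `x` within
    -- the cone. The form `j` then vanishes in addition to all those that vanish at `x`, so fewer
    -- forms are nonzero.
    obtain ⟨j, hj, hmin⟩ := (Finset.univ.filter fun i => pairing (ℓ i) (v k) < 0).exists_min_image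
      (fun i => pairing (ℓ i) x / pairing (ℓ i) (v k)) ⟨i₀, by simpa using hi₀⟩
    have hj : pairing (ℓ j) (v k) < 0 := by simpa using hj
    set r := pairing (ℓ j) x / pairing (ℓ j) (v k) with hr
    have hr0 : 0 ≤ r := div_nonneg_of_nonpos (hx j) hj.le
    have hy : ∀ i, pairing (ℓ i) (x - r • v k) ≤ 0 := by
      intro i
      rw [pairing_sub, pairing_smul]
      rcases (hnonpos i k).lt_or_eq with h | h
      · have := hmin i (by simpa using h)
        rw [le_div_iff_of_neg h] at this
        linarith
      · rw [h]
        linarith [hx i]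
    have hyj : pairing (ℓ j) (x - r • v k) = 0 := by
      rw [pairing_sub, pairing_smul, hr]
      field_simp [hj.ne]
      ring
    obtain ⟨c, hc, hsum⟩ := ih _ (by
      rw [← hn]
      refine Finset.card_lt_card (Finset.ssubset_iff_of_subset ?_ |>.2 ⟨j, ?_, ?_⟩)
      · intro i
        simp only [Finset.mem_filter, Finset.mem_univ, true_and]
        intro h h'
        exact h (by rw [pairing_sub, pairing_smul, h', hk i h']; simp)
      · simpa using fun h => hj.ne (hk j h)
      · simpa using hyj) _ hy rfl
    refine ⟨fun l => c l + if l = k then r else 0, fun l => ?_, ?_⟩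
    · have := hc l
      dsimp only
      split_ifs <;> linarith
    · simp only [add_smul, Finset.sum_add_distrib, ← hsum, ite_smul, zero_smul,
        Finset.sum_ite_eq', Finset.mem_univ, if_true]
      abel

variable {ℓ : I → V} {v : K → V}

theorem cls_mem_iInter_halfSpace (x : {x : V // x ≠ 0}) :
    cls x ∈ ⋂ i, halfSpace (ℓ i) ↔ ∀ i, pairing (ℓ i) x.1 ≤ 0 := by
  simp [cls_mem_halfSpace]

theorem interior_iInter_halfSpace_nonempty [Fintype I] (h : ∃ x, x ≠ 0 ∧ ∀ i, pairing (ℓ i) x < 0) :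
    (interior (⋂ i, halfSpace (ℓ i))).Nonempty := by
  obtain ⟨o, ho0, ho⟩ := h
  have hinv : ∀ x (c : ℝ), 0 < c → (∀ i, pairing (ℓ i) x < 0) → ∀ i, pairing (ℓ i) (c • x) < 0 :=
    fun x c hc hx i => by rw [pairing_smul]; exact mul_neg_of_pos_of_neg hc (hx i)
  refine ⟨cls ⟨o, ho0⟩, mem_interior.2 ⟨projSet fun x => ∀ i, pairing (ℓ i) x < 0, ?_, ?_, ?_⟩⟩
  · rintro _ ⟨x, hx, rfl⟩
    exact (cls_mem_iInter_halfSpace x).2 fun i => (hx i).le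
  · refine isOpen_projSet hinv ?_
    simp only [ofPred_forall]
    exact isOpen_iInter_of_finite fun i => isOpen_lt (continuous_pairing _) continuous_const
  · exact (cls_mem_projSet hinv _).2 ho

/-- The set of points of the polytope where the forms `ℓ i` with `i ∈ T` vanish. -/
def tightFace (ℓ : I → V) (T : Set I) : Set S4 :=
  (⋂ i, halfSpace (ℓ i)) ∩ ⋂ i ∈ T, hyperplane (ℓ i)

theorem cls_mem_tightFace {T : Set I} (x : {x : V // x ≠ 0}) :
    cls x ∈ tightFace ℓ T ↔
      (∀ i, pairing (ℓ i) x.1 ≤ 0) ∧ ∀ i ∈ T, pairing (ℓ i) x.1 = 0 := by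
  simp [tightFace, cls_mem_halfSpace, cls_mem_hyperplane]

namespace IsGeneratedBy

/-- A form that is nonpositive on the generators and vanishes at a nonnegative combination of
them vanishes at the generators that occur in the combination. -/
theorem pairing_eq_zero_of_sum {v : K → V} {α : V} {c : K → ℝ} (hα : ∀ k, pairing α (v k) ≤ 0)
    (hc : ∀ k, 0 ≤ c k) (h : pairing α (∑ k, c k • v k) = 0) {k : K} (hk : c k ≠ 0) :
    pairing α (v k) = 0 := by
  rw [pairing_sum] at h
  have := (Finset.sum_eq_zero_iff_of_nonpos (fun k _ => by
    rw [pairing_smul]; exact mul_nonpos_of_nonneg_of_nonpos (hc k) (hα k))).1 h k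
      (Finset.mem_univ k)
  rw [pairing_smul] at this
  exact (mul_eq_zero.1 this).resolve_left hk

theorem exists_coeff_ne_zero {v : K → V} {c : K → ℝ} {x : V} (hx : x ≠ 0)
    (h : x = ∑ k, c k • v k) : ∃ k, c k ≠ 0 := by
  by_contra! hc
  exact hx (by simp [h, hc])

variable (hg : IsGeneratedBy ℓ v)
include hg

theorem cls_mem (k : K) : cls ⟨v k, hg.ne_zero k⟩ ∈ ⋂ i, halfSpace (ℓ i) :=
  (cls_mem_iInter_halfSpace _).2 fun i => hg.nonpos i k

theorem cls_mem_tightFace_iff (T : Set I) (k : K) :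
    cls ⟨v k, hg.ne_zero k⟩ ∈ tightFace ℓ T ↔ ∀ i ∈ T, pairing (ℓ i) (v k) = 0 := by
  rw [cls_mem_tightFace]
  exact and_iff_right fun i => hg.nonpos i k

theorem cls_injective
    (hext : ∀ k l, (∀ i, pairing (ℓ i) (v k) = 0 → pairing (ℓ i) (v l) = 0) → k = l) :
    Function.Injective fun k => cls ⟨v k, hg.ne_zero k⟩ := by
  intro k l hkl
  obtain ⟨c, -, h⟩ := cls_eq_cls_iff.1 hkl
  refine hext k l fun i hi => ?_
  have h : c • v k = v l := h
  rw [← h, pairing_smul, hi, mul_zero]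

/-- A face is determined by its generators: if a point of the face is written as a nonnegative
combination, every generator with nonzero coefficient lies in the face too, because the forms of `T`
are nonpositive on all generators. -/
theorem tightFace_subset_iff {T T' : Set I} :
    tightFace ℓ T ⊆ tightFace ℓ T' ↔
      ∀ k, (∀ i ∈ T, pairing (ℓ i) (v k) = 0) → ∀ i ∈ T', pairing (ℓ i) (v k) = 0 := by
  constructor
  · intro h k hk
    exact (hg.cls_mem_tightFace_iff T' k).1 (h ((hg.cls_mem_tightFace_iff T k).2 hk))
  · intro h p hp
    obtain ⟨x, rfl⟩ := cls_surjective p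
    rw [cls_mem_tightFace] at hp ⊢
    refine ⟨hp.1, fun i hi => ?_⟩
    obtain ⟨c, hc, hsum⟩ := hg.exists_sum _ hp.1
    rw [hsum, pairing_sum]
    refine Finset.sum_eq_zero fun k _ => ?_
    rw [pairing_smul, mul_eq_zero, or_iff_not_imp_left]
    intro hk
    refine h k (fun j hj => ?_) i hi
    have := hp.2 j hj
    rw [hsum] at this
    exact pairing_eq_zero_of_sum (hg.nonpos j) hc this hk

theorem tightFace_nonempty_iff {T : Set I} :
    (tightFace ℓ T).Nonempty ↔ ∃ k, ∀ i ∈ T, pairing (ℓ i) (v k) = 0 := by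
  constructor
  · rintro ⟨p, hp⟩
    obtain ⟨x, rfl⟩ := cls_surjective p
    rw [cls_mem_tightFace] at hp
    obtain ⟨c, hc, hsum⟩ := hg.exists_sum _ hp.1
    obtain ⟨k, hk⟩ := exists_coeff_ne_zero x.2 hsum
    refine ⟨k, fun j hj => ?_⟩
    have := hp.2 j hj
    rw [hsum] at this
    exact pairing_eq_zero_of_sum (hg.nonpos j) hc this hk
  · rintro ⟨k, hk⟩
    exact ⟨_, (hg.cls_mem_tightFace_iff T k).2 hk⟩

variable [Fintype I]

theorem isFace_tightFace {T : Set I} (hT : (tightFace ℓ T).Nonempty) :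
    IsFace (⋂ i, halfSpace (ℓ i)) (tightFace ℓ T) := by
  classical
  refine ⟨hT, ?_⟩
  rcases T.eq_empty_or_nonempty with rfl | ⟨i₀, hi₀⟩
  · left
    simp [tightFace]
  right
  have key : ∀ x : V, (∀ i, pairing (ℓ i) x ≤ 0) →
      ∀ i ∈ Finset.univ.filter (· ∈ T), pairing (ℓ i) x ≤ 0 := fun x hx i _ => hx i
  -- A sum of nonpositive numbers vanishes only if every term does, so the sum of the forms in `T`
  -- cuts out exactly this face. It is a nonzero form because it is negative at the interior point.
  refine ⟨∑ i ∈ Finset.univ.filter (· ∈ T), ℓ i, ?_, ?_, ?_⟩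
  · intro h
    obtain ⟨o, -, ho⟩ := hg.exists_neg
    have h1 : pairing (∑ i ∈ Finset.univ.filter (· ∈ T), ℓ i) o < 0 := by
      rw [sum_pairing]
      exact Finset.sum_neg (fun i _ => ho i) ⟨i₀, by simpa using hi₀⟩
    rw [h, zero_pairing] at h1
    exact h1.ne rfl
  · intro p hp
    obtain ⟨x, rfl⟩ := cls_surjective p
    rw [cls_mem_iInter_halfSpace] at hp
    rw [cls_mem_halfSpace, sum_pairing]
    exact Finset.sum_nonpos (key _ hp)
  · ext p
    obtain ⟨x, rfl⟩ := cls_surjective p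
    rw [cls_mem_tightFace, mem_inter_iff, cls_mem_iInter_halfSpace, cls_mem_hyperplane, sum_pairing]
    refine and_congr_right fun hx => ?_
    rw [Finset.sum_eq_zero_iff_of_nonpos (key _ hx)]
    simp

/-- Let `S` be the generators on which the supporting form `α` vanishes, and take for `T` the forms
that vanish on all of `S`. The sum `y` of `S` plays the part of a relative interior point of the
face: a form vanishing at `y` belongs to `T`. Hence if the forms of `T` vanish at `x`, then `y - δx`
stays in the cone for small `δ > 0`, and `α(y - δx) ≤ 0` together with `α(y) = 0` forces `α(x) ≥ 0`.
-/
theorem exists_eq_tightFace {F : Set S4} (hF : IsFace (⋂ i, halfSpace (ℓ i)) F) :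
    ∃ T, F = tightFace ℓ T := by
  classical
  obtain ⟨-, rfl | ⟨α, -, hα, rfl⟩⟩ := hF
  · exact ⟨∅, by simp [tightFace]⟩
  have hαv : ∀ x, (∀ i, pairing (ℓ i) x ≤ 0) → pairing α x ≤ 0 := by
    intro x hx
    by_cases hx0 : x = 0
    · rw [hx0, pairing_zero]
    · exact (cls_mem_halfSpace ⟨x, hx0⟩).1 (hα ((cls_mem_iInter_halfSpace _).2 hx))
  have hαk : ∀ k, pairing α (v k) ≤ 0 := fun k => hαv _ fun i => hg.nonpos i k
  set S : Finset K := Finset.univ.filter fun k => pairing α (v k) = 0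
  refine ⟨{i | ∀ k ∈ S, pairing (ℓ i) (v k) = 0}, ?_⟩
  ext p
  obtain ⟨x, rfl⟩ := cls_surjective p
  rw [cls_mem_tightFace, mem_inter_iff, cls_mem_iInter_halfSpace, cls_mem_hyperplane]
  refine and_congr_right fun hx => ⟨fun h i hi => ?_, fun h => ?_⟩
  · obtain ⟨c, hc, hsum⟩ := hg.exists_sum _ hx
    rw [hsum, pairing_sum]
    refine Finset.sum_eq_zero fun k _ => ?_
    rw [pairing_smul, mul_eq_zero, or_iff_not_imp_left]
    intro hk
    rw [hsum] at h
    exact hi k (by simpa [S] using pairing_eq_zero_of_sum hαk hc h hk)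
  · set y : V := ∑ k ∈ S, v k with hy
    have hyα : pairing α y = 0 := by
      rw [hy, pairing_sum]
      exact Finset.sum_eq_zero fun k hk => by simpa [S] using hk
    have hyi : ∀ i, pairing (ℓ i) y ≤ 0 := fun i => by
      rw [hy, pairing_sum]
      exact Finset.sum_nonpos fun k _ => hg.nonpos i k
    have hev : ∀ᶠ δ in 𝓝[>] (0 : ℝ), ∀ i, pairing (ℓ i) (y - δ • x.1) ≤ 0 := by
      rw [eventually_all]
      intro i
      rcases (hyi i).lt_or_eq with hlt | heq
      · have hcont : Continuous fun δ : ℝ => pairing (ℓ i) (y - δ • x.1) :=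
          (continuous_pairing _).comp (by fun_prop)
        have : ∀ᶠ δ in 𝓝 (0 : ℝ), pairing (ℓ i) (y - δ • x.1) < 0 :=
          hcont.continuousAt.eventually_lt continuousAt_const (by simpa using hlt)
        exact (this.filter_mono nhdsWithin_le_nhds).mono fun _ h => h.le
      · have hzero : ∀ k ∈ S, pairing (ℓ i) (v k) = 0 := by
          rw [hy, pairing_sum] at heq
          exact (Finset.sum_eq_zero_iff_of_nonpos fun k _ => hg.nonpos i k).1 heq
        exact Eventually.of_forall fun δ => by
          rw [pairing_sub, pairing_smul, heq, h i hzero]; simp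
    obtain ⟨δ, hδ, hδ0⟩ := (hev.and self_mem_nhdsWithin).exists
    have h1 := hαv _ hδ
    rw [pairing_sub, pairing_smul, hyα, zero_sub, neg_nonpos] at h1
    exact le_antisymm (hαv _ hx) (nonneg_of_mul_nonneg_right h1 hδ0)

/-- The embedding of the face poset into the sets of generators. -/
def faceEmbedding : Faces (⋂ i, halfSpace (ℓ i)) ↪o Set K :=
  OrderEmbedding.ofMapLEIff (fun F => {k | cls ⟨v k, hg.ne_zero k⟩ ∈ F.1}) fun F F' => by
    obtain ⟨T, hT⟩ := hg.exists_eq_tightFace F.2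
    obtain ⟨T', hT'⟩ := hg.exists_eq_tightFace F'.2
    rw [← Subtype.coe_le_coe, hT, hT']
    simp only [hg.cls_mem_tightFace_iff]
    exact hg.tightFace_subset_iff.symm

/-- The right-hand side mentions only which forms vanish on which generators, so two families with
the same incidences have isomorphic face posets. -/
theorem range_faceEmbedding : range hg.faceEmbedding =
    {S | S.Nonempty ∧ ∃ T : Set I, S = {k | ∀ i ∈ T, pairing (ℓ i) (v k) = 0}} := by
  ext S
  constructor
  · rintro ⟨F, rfl⟩
    obtain ⟨T, hT⟩ := hg.exists_eq_tightFace F.2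
    have h : hg.faceEmbedding F = {k | ∀ i ∈ T, pairing (ℓ i) (v k) = 0} := by
      ext k
      change cls _ ∈ F.1 ↔ _
      rw [hT, hg.cls_mem_tightFace_iff, mem_ofPred_eq]
    refine ⟨?_, T, h⟩
    rw [h]
    exact hg.tightFace_nonempty_iff.1 (hT ▸ F.2.1)
  · rintro ⟨hS, T, rfl⟩
    refine ⟨⟨tightFace ℓ T, hg.isFace_tightFace (hg.tightFace_nonempty_iff.2 hS)⟩, ?_⟩
    ext k
    exact hg.cls_mem_tightFace_iff T k

theorem sameCombinatorics {ℓ' : I → V} {v' : K → V} (hg' : IsGeneratedBy ℓ' v')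
    (h : ∀ i k, pairing (ℓ i) (v k) = 0 ↔ pairing (ℓ' i) (v' k) = 0) :
    SameCombinatorics (⋂ i, halfSpace (ℓ i)) (⋂ i, halfSpace (ℓ' i)) := by
  have hr : range hg.faceEmbedding = range hg'.faceEmbedding := by
    rw [range_faceEmbedding, range_faceEmbedding]
    simp only [h]
  exact ⟨hg.faceEmbedding.orderIso.trans
    ((OrderIso.setCongr _ _ hr).trans hg'.faceEmbedding.orderIso.symm)⟩

/-- If no generator lies in the smallest face containing another one, then the vertices are the
classes of the generators. -/
theorem vertices_eq
    (hext : ∀ k l, (∀ i, pairing (ℓ i) (v k) = 0 → pairing (ℓ i) (v l) = 0) → k = l) :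
    vertices (⋂ i, halfSpace (ℓ i)) = range fun k => cls ⟨v k, hg.ne_zero k⟩ := by
  classical
  ext p
  constructor
  · intro hp
    obtain ⟨T, hT⟩ := hg.exists_eq_tightFace hp
    obtain ⟨k, hk⟩ := hg.tightFace_nonempty_iff.1 (hT ▸ singleton_nonempty p)
    have := (hg.cls_mem_tightFace_iff T k).2 hk
    rw [← hT] at this
    exact ⟨k, this⟩
  · rintro ⟨k, rfl⟩
    -- The smallest face containing `v k` is a single point: by `hext` no other generator can occur
    -- in a combination that lies in it.
    have : {cls ⟨v k, hg.ne_zero k⟩} = tightFace ℓ {i | pairing (ℓ i) (v k) = 0} := by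
      refine Subset.antisymm (singleton_subset_iff.2 ?_) fun p hp => ?_
      · exact (hg.cls_mem_tightFace_iff _ k).2 fun i hi => hi
      · obtain ⟨x, rfl⟩ := cls_surjective p
        rw [cls_mem_tightFace] at hp
        obtain ⟨c, hc, hsum⟩ := hg.exists_sum _ hp.1
        have hck : ∀ l, l ≠ k → c l = 0 := by
          intro l hl
          by_contra hcl
          refine hl (hext k l fun i hi => ?_).symm
          have := hp.2 i hi
          rw [hsum] at this
          exact pairing_eq_zero_of_sum (hg.nonpos i) hc this hcl
        have hx : x.1 = c k • v k := by
          rw [hsum]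
          exact Finset.sum_eq_single k (fun l _ hl => by rw [hck l hl, zero_smul]) (by simp)
        have hc0 : c k ≠ 0 := fun h => x.2 (by rw [hx, h, zero_smul])
        exact (cls_eq_cls_iff.2 ⟨c k, (hc k).lt_of_ne' hc0, hx.symm⟩).symm
    change IsFace _ _
    rw [this]
    exact hg.isFace_tightFace (this ▸ singleton_nonempty _)

end IsGeneratedBy

end Cone

/-! ### Reduced coordinates and the vertices -/

/-- The vector with reduced coordinates `(h; a, b, c; w)`. -/
def point (h a b c w : ℝ) : V := ![√2 * h, a, b, c, w]

theorem exists_eq_point (x : V) : ∃ h a b c w, x = point h a b c w := by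
  refine ⟨x 0 / √2, x 1, x 2, x 3, x 4, ?_⟩
  ext i
  fin_cases i <;> simp [point, mul_div_cancel₀]

/-- The signs `ε` of the half-spaces `0^±, …, 7^±`. -/
def sgn : Fin 8 → Fin 3 → ℤ :=
  ![![1, 1, 1], ![1, -1, 1], ![1, -1, -1], ![1, 1, -1],
    ![-1, 1, -1], ![-1, 1, 1], ![-1, -1, 1], ![-1, -1, -1]]

/-- The product of the three signs. -/
def eta (e : Fin 8) : ℤ := sgn e 0 * sgn e 1 * sgn e 2

/-- The coordinate that occurs in the form `A, …, F`. -/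
def letterIdx : Fin 6 → Fin 3 := ![0, 1, 2, 2, 1, 0]

/-- The sign with which it occurs. -/
def letterSgn : Fin 6 → ℤ := ![1, 1, 1, -1, -1, -1]

/-- The rescaled linear forms in reduced coordinates, up to positive factors; here `s = t |t|`. -/
def form (s : ℝ) : Idx → ℝ → ℝ → ℝ → ℝ → ℝ → ℝ
  | .inl e, h, a, b, c, w => sgn e 0 * a + sgn e 1 * b + sgn e 2 * c + eta e * w - 2 * h
  | .inr (.inl e), h, a, b, c, w =>
      sgn e 0 * a + sgn e 1 * b + sgn e 2 * c - eta e * (s * w) - 2 * h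
  | .inr (.inr l), h, a, b, c, _ => letterSgn l * ![a, b, c] (letterIdx l) - h

/-- The factor is `√2` for the walls `A, …, F` and `1` for the others; only the signs of the forms
matter afterwards. -/
theorem exists_pairing_eq (t : ℝ) (i : Idx) : ∃ r : ℝ, 0 < r ∧ ∀ h a b c w,
    pairing (rescaledWall t i) (point h a b c w) = r * form (t * |t|) i h a b c w := by
  have h2 : √2 * √2 = 2 := Real.mul_self_sqrt (by norm_num)
  rcases i with e | e | l
  · refine ⟨1, one_pos, fun h a b c w => ?_⟩
    fin_cases e <;>
      simp [pairing, rescaledWall, rescaledPlus, point, form, sgn, eta, Fin.sum_univ_five] <;>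
      linear_combination -h * h2
  · refine ⟨1, one_pos, fun h a b c w => ?_⟩
    fin_cases e <;>
      simp [pairing, rescaledWall, rescaledMinus, point, form, sgn, eta, Fin.sum_univ_five] <;>
      linear_combination -h * h2
  · refine ⟨√2, by positivity, fun h a b c w => ?_⟩
    fin_cases l <;>
      simp [pairing, rescaledWall, wallLetter, point, form, letterSgn, letterIdx,
        Fin.sum_univ_five] <;>
      ring

theorem pairing_nonpos_iff {t : ℝ} {i : Idx} {h a b c w : ℝ} :
    pairing (rescaledWall t i) (point h a b c w) ≤ 0 ↔ form (t * |t|) i h a b c w ≤ 0 := by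
  obtain ⟨r, hr, hf⟩ := exists_pairing_eq t i
  rw [hf]
  exact ⟨fun hle => nonpos_of_mul_nonpos_right hle hr, mul_nonpos_of_nonneg_of_nonpos hr.le⟩

theorem pairing_neg_iff {t : ℝ} {i : Idx} {h a b c w : ℝ} :
    pairing (rescaledWall t i) (point h a b c w) < 0 ↔ form (t * |t|) i h a b c w < 0 := by
  obtain ⟨r, hr, hf⟩ := exists_pairing_eq t i
  rw [hf]
  exact ⟨fun hlt => neg_of_mul_neg_right hlt hr.le, mul_neg_of_pos_of_neg hr⟩

theorem pairing_eq_zero_iff {t : ℝ} {i : Idx} {h a b c w : ℝ} :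
    pairing (rescaledWall t i) (point h a b c w) = 0 ↔ form (t * |t|) i h a b c w = 0 := by
  obtain ⟨r, hr, hf⟩ := exists_pairing_eq t i
  rw [hf, mul_eq_zero, or_iff_right hr.ne']

/-- Index set of the 46 vertices. -/
abbrev VertexIdx : Type := Fin 2 ⊕ Fin 12 ⊕ Fin 8 ⊕ (Fin 8 × Fin 3)

/-- The signs of the two vertices on the axis. -/
def axisSgn : Fin 2 → ℤ := ![1, -1]

/-- The spatial coordinates of the ideal vertices. -/
def idealCoord : Fin 12 → Fin 3 → ℤ :=
  ![![1, 1, 0], ![1, -1, 0], ![-1, 1, 0], ![-1, -1, 0], ![1, 0, 1], ![1, 0, -1],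
    ![-1, 0, 1], ![-1, 0, -1], ![0, 1, 1], ![0, 1, -1], ![0, -1, 1], ![0, -1, -1]]

/-- The absolute value of the `j`-th coordinate of the vertices `(e, i)`. -/
def edgeCoord (s : ℝ) (i j : Fin 3) : ℝ := if j = i then 2 else 1 - s

/-- The vertices. -/
def vert (s : ℝ) : VertexIdx → V
  | .inl j => point 1 0 0 0 (2 * axisSgn j)
  | .inr (.inl j) => point 1 (idealCoord j 0) (idealCoord j 1) (idealCoord j 2) 0
  -- With spatial part `m` times the sign vector and `w = -4η`, vanishing of `e⁻` and of the three
  -- `f⁺` with `f` one sign away from `e` means `3m + 4s = 2h` and `m + 4 = 2h`, so `h = 3 - s` and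
  -- `m = 2 - 2s`.
  | .inr (.inr (.inl e)) =>
      point (3 - s) ((2 - 2 * s) * sgn e 0) ((2 - 2 * s) * sgn e 1) ((2 - 2 * s) * sgn e 2)
        (-4 * eta e)
  -- With `h = 2`, the lettered wall fixes the `i`-th coordinate to be `2` in absolute value; `e⁻`
  -- then gives `2 + 2m + 2s = 4` for the common absolute value `m = 1 - s` of the other two.
  | .inr (.inr (.inr (e, i))) =>
      point 2 (edgeCoord s i 0 * sgn e 0) (edgeCoord s i 1 * sgn e 1) (edgeCoord s i 2 * sgn e 2)
        (-2 * eta e)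

/-- The inner product of two sign vectors. -/
def sgnProd (e f : Fin 8) : ℤ := sgn e 0 * sgn f 0 + sgn e 1 * sgn f 1 + sgn e 2 * sgn f 2

/-- The inner product of a sign vector with the coordinates of an ideal vertex. -/
def idealProd (e : Fin 8) (j : Fin 12) : ℤ :=
  sgn e 0 * idealCoord j 0 + sgn e 1 * idealCoord j 1 + sgn e 2 * idealCoord j 2

/-- The incidences between the 22 walls and the 46 vertices. -/
def inc : Idx → VertexIdx → Bool
  | .inl e, .inl j => eta e * axisSgn j = 1
  | .inl e, .inr (.inl j) => idealProd e j = 2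
  | .inl e, .inr (.inr (.inl f)) => sgnProd e f = 1
  | .inl e, .inr (.inr (.inr (f, i))) => sgnProd e f = 1 ∧ sgn e i * sgn f i = 1
  | .inr (.inl _), .inl _ => false
  | .inr (.inl e), .inr (.inl j) => idealProd e j = 2
  | .inr (.inl e), .inr (.inr (.inl f)) => e = f
  | .inr (.inl e), .inr (.inr (.inr (f, _))) => e = f
  | .inr (.inr _), .inl _ => false
  | .inr (.inr l), .inr (.inl j) => letterSgn l * idealCoord j (letterIdx l) = 1
  | .inr (.inr _), .inr (.inr (.inl _)) => false
  | .inr (.inr l), .inr (.inr (.inr (f, i))) => letterIdx l = i ∧ letterSgn l * sgn f i = 1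

set_option synthInstance.maxHeartbeats 200000 in
set_option synthInstance.maxSize 2000 in
-- The sets of walls through distinct vertices are incomparable, a finite check. This makes each of
-- the 46 vectors span an extreme ray and keeps their classes distinct.
theorem eq_of_inc_imp : ∀ k l, (∀ i, inc i k → inc i l) → k = l := by
  decide +kernel

/-! ### Incidences between walls and vertices -/

/-- The value of the `i`-th form at the `k`-th vertex. -/
def value (s : ℝ) (i : Idx) : VertexIdx → ℝ
  | .inl j => form s i 1 0 0 0 (2 * axisSgn j)
  | .inr (.inl j) => form s i 1 (idealCoord j 0) (idealCoord j 1) (idealCoord j 2) 0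
  | .inr (.inr (.inl e)) =>
      form s i (3 - s) ((2 - 2 * s) * sgn e 0) ((2 - 2 * s) * sgn e 1) ((2 - 2 * s) * sgn e 2)
        (-4 * eta e)
  | .inr (.inr (.inr (e, k))) =>
      form s i 2 (edgeCoord s k 0 * sgn e 0) (edgeCoord s k 1 * sgn e 1)
        (edgeCoord s k 2 * sgn e 2) (-2 * eta e)

theorem eta_mul_axisSgn (e : Fin 8) (j : Fin 2) :
    eta e * axisSgn j = 1 ∨ eta e * axisSgn j = -1 := by
  revert e j
  decide

theorem idealProd_cases (e : Fin 8) (j : Fin 12) :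
    idealProd e j = 2 ∨ idealProd e j = 0 ∨ idealProd e j = -2 := by
  revert e j
  decide

/-- If two sign vectors differ in `d` places, their inner product is `3 - 2d` and the product of
their `η` is `(-1)^d`. -/
theorem sgnProd_cases (e f : Fin 8) :
    (e = f ∧ sgnProd e f = 3 ∧ eta e * eta f = 1) ∨
    (e ≠ f ∧ sgnProd e f = 1 ∧ eta e * eta f = -1) ∨
    (e ≠ f ∧ sgnProd e f = -1 ∧ eta e * eta f = 1) ∨
    (e ≠ f ∧ sgnProd e f = -3 ∧ eta e * eta f = -1) := by
  revert e f
  decide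

theorem sgnProd_coord_cases (e f : Fin 8) (i : Fin 3) :
    (e = f ∧ sgnProd e f = 3 ∧ eta e * eta f = 1 ∧ sgn e i * sgn f i = 1) ∨
    (e ≠ f ∧ sgnProd e f = 1 ∧ eta e * eta f = -1 ∧ sgn e i * sgn f i = 1) ∨
    (e ≠ f ∧ sgnProd e f = 1 ∧ eta e * eta f = -1 ∧ sgn e i * sgn f i = -1) ∨
    (e ≠ f ∧ sgnProd e f = -1 ∧ eta e * eta f = 1 ∧ sgn e i * sgn f i = 1) ∨
    (e ≠ f ∧ sgnProd e f = -1 ∧ eta e * eta f = 1 ∧ sgn e i * sgn f i = -1) ∨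
    (e ≠ f ∧ sgnProd e f = -3 ∧ eta e * eta f = -1 ∧ sgn e i * sgn f i = -1) := by
  revert e f i
  decide

theorem letter_ideal_cases (l : Fin 6) (j : Fin 12) :
    letterSgn l * idealCoord j (letterIdx l) = 1 ∨
    letterSgn l * idealCoord j (letterIdx l) = 0 ∨
    letterSgn l * idealCoord j (letterIdx l) = -1 := by
  revert l j
  decide

theorem letter_sgn_cases (l : Fin 6) (f : Fin 8) (i : Fin 3) :
    letterSgn l * sgn f i = 1 ∨ letterSgn l * sgn f i = -1 := by
  revert l f i
  decide

/-- Since `2 = (1 - s) + (1 + s)`, the spatial part of the vertex `(f, i)` is `1 - s` times the sign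
vector of `f` plus `(1 + s) · sgn f i` in the direction `i`. -/
theorem sum_edgeCoord (s : ℝ) (e f : Fin 8) (i : Fin 3) :
    (sgn e 0 : ℝ) * (edgeCoord s i 0 * sgn f 0) + sgn e 1 * (edgeCoord s i 1 * sgn f 1)
      + sgn e 2 * (edgeCoord s i 2 * sgn f 2)
      = (1 - s) * (sgnProd e f : ℤ) + (1 + s) * (sgn e i * sgn f i : ℤ) := by
  simp only [sgnProd]
  push_cast
  fin_cases i <;> simp [edgeCoord] <;> ring

theorem eq_zero_iff_of_neg {x : ℝ} {b : Bool} (hx : x < 0) (hb : b = false) :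
    x ≤ 0 ∧ (x = 0 ↔ b = true) := by
  simp [hb, hx.le, hx.ne]

theorem eq_zero_iff_of_eq {x : ℝ} {b : Bool} (hx : x = 0) (hb : b = true) :
    x ≤ 0 ∧ (x = 0 ↔ b = true) := by
  simp [hb, hx]

/-- Each value depends only on a few sign products and is affine in `s`. It is either identically
zero or negative throughout `-1 < s < 1`, so the incidences do not change with `s`. -/
theorem value_nonpos_and_eq_zero_iff {s : ℝ} (hs : -1 < s) (hs' : s ≤ 1 / 3) (i : Idx)
    (k : VertexIdx) : value s i k ≤ 0 ∧ (value s i k = 0 ↔ inc i k) := by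
  rcases i with e | e | l <;> rcases k with j | j | f | ⟨f, k⟩
  · have h : value s (.inl e) (.inl j) = 2 * (eta e * axisSgn j : ℤ) - 2 := by
      simp only [value, form]; push_cast; ring
    rw [h]
    rcases eta_mul_axisSgn e j with h | h
    · exact eq_zero_iff_of_eq (by rw [h]; norm_num) (by simp [inc, h])
    · exact eq_zero_iff_of_neg (by rw [h]; norm_num) (by simp [inc, h])
  · have h : value s (.inl e) (.inr (.inl j)) = (idealProd e j : ℤ) - 2 := by
      simp only [value, form, idealProd]; push_cast; ring
    rw [h]
    rcases idealProd_cases e j with h | h | h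
    · exact eq_zero_iff_of_eq (by rw [h]; norm_num) (by simp [inc, h])
    · exact eq_zero_iff_of_neg (by rw [h]; norm_num) (by simp [inc, h])
    · exact eq_zero_iff_of_neg (by rw [h]; norm_num) (by simp [inc, h])
  · have h : value s (.inl e) (.inr (.inr (.inl f))) =
        (2 - 2 * s) * (sgnProd e f : ℤ) - 4 * (eta e * eta f : ℤ) - 2 * (3 - s) := by
      simp only [value, form, sgnProd]; push_cast; ring
    rw [h]
    rcases sgnProd_cases e f with ⟨h0, h1, h2⟩ | ⟨h0, h1, h2⟩ | ⟨h0, h1, h2⟩ | ⟨h0, h1, h2⟩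
    · exact eq_zero_iff_of_neg (by rw [h1, h2]; push_cast; linarith) (by simp [inc, h1])
    · exact eq_zero_iff_of_eq (by rw [h1, h2]; push_cast; ring) (by simp [inc, h1])
    · exact eq_zero_iff_of_neg (by rw [h1, h2]; push_cast; linarith) (by simp [inc, h1])
    · exact eq_zero_iff_of_neg (by rw [h1, h2]; push_cast; linarith) (by simp [inc, h1])
  · have h : value s (.inl e) (.inr (.inr (.inr (f, k)))) =
        (1 - s) * (sgnProd e f : ℤ) + (1 + s) * (sgn e k * sgn f k : ℤ)
          - 2 * (eta e * eta f : ℤ) - 4 := by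
      simp only [value, form, sum_edgeCoord]; push_cast; ring
    rw [h]
    rcases sgnProd_coord_cases e f k with ⟨h0, h1, h2, h3⟩ | ⟨h0, h1, h2, h3⟩ | ⟨h0, h1, h2, h3⟩ |
      ⟨h0, h1, h2, h3⟩ | ⟨h0, h1, h2, h3⟩ | ⟨h0, h1, h2, h3⟩
    · exact eq_zero_iff_of_neg (by rw [h1, h2, h3]; push_cast; linarith) (by simp [inc, h1])
    · exact eq_zero_iff_of_eq (by rw [h1, h2, h3]; push_cast; ring) (by simp [inc, h1, h3])
    · exact eq_zero_iff_of_neg (by rw [h1, h2, h3]; push_cast; linarith) (by simp [inc, h3])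
    · exact eq_zero_iff_of_neg (by rw [h1, h2, h3]; push_cast; linarith) (by simp [inc, h1])
    · exact eq_zero_iff_of_neg (by rw [h1, h2, h3]; push_cast; linarith) (by simp [inc, h1])
    · exact eq_zero_iff_of_neg (by rw [h1, h2, h3]; push_cast; linarith) (by simp [inc, h1])
  · have h : value s (.inr (.inl e)) (.inl j) = - (2 * s) * (eta e * axisSgn j : ℤ) - 2 := by
      simp only [value, form]; push_cast; ring
    rw [h]
    rcases eta_mul_axisSgn e j with h | h
    · exact eq_zero_iff_of_neg (by rw [h]; push_cast; linarith) rfl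
    · exact eq_zero_iff_of_neg (by rw [h]; push_cast; linarith) rfl
  · have h : value s (.inr (.inl e)) (.inr (.inl j)) = (idealProd e j : ℤ) - 2 := by
      simp only [value, form, idealProd]; push_cast; ring
    rw [h]
    rcases idealProd_cases e j with h | h | h
    · exact eq_zero_iff_of_eq (by rw [h]; norm_num) (by simp [inc, h])
    · exact eq_zero_iff_of_neg (by rw [h]; norm_num) (by simp [inc, h])
    · exact eq_zero_iff_of_neg (by rw [h]; norm_num) (by simp [inc, h])
  · have h : value s (.inr (.inl e)) (.inr (.inr (.inl f))) =
        (2 - 2 * s) * (sgnProd e f : ℤ) + 4 * s * (eta e * eta f : ℤ) - 2 * (3 - s) := by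
      simp only [value, form, sgnProd]; push_cast; ring
    rw [h]
    rcases sgnProd_cases e f with ⟨h0, h1, h2⟩ | ⟨h0, h1, h2⟩ | ⟨h0, h1, h2⟩ | ⟨h0, h1, h2⟩
    · exact eq_zero_iff_of_eq (by rw [h1, h2]; push_cast; ring) (by simp [inc, h0])
    · exact eq_zero_iff_of_neg (by rw [h1, h2]; push_cast; linarith) (by simp [inc, h0])
    · exact eq_zero_iff_of_neg (by rw [h1, h2]; push_cast; linarith) (by simp [inc, h0])
    · exact eq_zero_iff_of_neg (by rw [h1, h2]; push_cast; linarith) (by simp [inc, h0])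
  · have h : value s (.inr (.inl e)) (.inr (.inr (.inr (f, k)))) =
        (1 - s) * (sgnProd e f : ℤ) + (1 + s) * (sgn e k * sgn f k : ℤ)
          + 2 * s * (eta e * eta f : ℤ) - 4 := by
      simp only [value, form, sum_edgeCoord]; push_cast; ring
    rw [h]
    rcases sgnProd_coord_cases e f k with ⟨h0, h1, h2, h3⟩ | ⟨h0, h1, h2, h3⟩ | ⟨h0, h1, h2, h3⟩ |
      ⟨h0, h1, h2, h3⟩ | ⟨h0, h1, h2, h3⟩ | ⟨h0, h1, h2, h3⟩
    · exact eq_zero_iff_of_eq (by rw [h1, h2, h3]; push_cast; ring) (by simp [inc, h0])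
    all_goals exact eq_zero_iff_of_neg (by rw [h1, h2, h3]; push_cast; linarith) (by simp [inc, h0])
  · have h : value s (.inr (.inr l)) (.inl j) = -1 := by
      simp only [value, form]
      generalize letterIdx l = i
      fin_cases i <;> simp
    rw [h]
    exact eq_zero_iff_of_neg (by norm_num) rfl
  · have h : value s (.inr (.inr l)) (.inr (.inl j)) =
        (letterSgn l * idealCoord j (letterIdx l) : ℤ) - 1 := by
      simp only [value, form]
      push_cast
      generalize letterIdx l = i
      fin_cases i <;> simp
    rw [h]
    rcases letter_ideal_cases l j with h | h | h
    · exact eq_zero_iff_of_eq (by rw [h]; norm_num) (by simp [inc, h])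
    · exact eq_zero_iff_of_neg (by rw [h]; norm_num) (by simp [inc, h])
    · exact eq_zero_iff_of_neg (by rw [h]; norm_num) (by simp [inc, h])
  · have h : value s (.inr (.inr l)) (.inr (.inr (.inl f))) =
        (2 - 2 * s) * (letterSgn l * sgn f (letterIdx l) : ℤ) - (3 - s) := by
      simp only [value, form]
      push_cast
      generalize letterIdx l = i
      fin_cases i <;> simp <;> ring
    rw [h]
    rcases letter_sgn_cases l f (letterIdx l) with h | h
    · exact eq_zero_iff_of_neg (by rw [h]; push_cast; linarith) rfl
    · exact eq_zero_iff_of_neg (by rw [h]; push_cast; linarith) rfl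
  · have h : value s (.inr (.inr l)) (.inr (.inr (.inr (f, k)))) =
        edgeCoord s k (letterIdx l) * (letterSgn l * sgn f (letterIdx l) : ℤ) - 2 := by
      simp only [value, form]
      push_cast
      generalize letterIdx l = i
      fin_cases i <;> simp <;> ring
    rw [h]
    rcases eq_or_ne (letterIdx l) k with rfl | hk
    · rcases letter_sgn_cases l f (letterIdx l) with h | h
      · exact eq_zero_iff_of_eq (by rw [h]; simp [edgeCoord]) (by simp [inc, h])
      · exact eq_zero_iff_of_neg (by rw [h]; simp [edgeCoord]) (by simp [inc, h])
    · rw [edgeCoord, if_neg hk]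
      rcases letter_sgn_cases l f (letterIdx l) with h | h
      · exact eq_zero_iff_of_neg (by rw [h]; push_cast; linarith) (by simp [inc, hk])
      · exact eq_zero_iff_of_neg (by rw [h]; push_cast; linarith) (by simp [inc, hk])

theorem pairing_vert_nonpos {t : ℝ} (hs : -1 < t * |t|) (hs' : t * |t| ≤ 1 / 3) (i : Idx)
    (k : VertexIdx) : pairing (rescaledWall t i) (vert (t * |t|) k) ≤ 0 := by
  have := (value_nonpos_and_eq_zero_iff hs hs' i k).1
  rcases k with j | j | f | ⟨f, k⟩ <;> exact pairing_nonpos_iff.2 this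

theorem pairing_vert_eq_zero_iff {t : ℝ} (hs : -1 < t * |t|) (hs' : t * |t| ≤ 1 / 3) (i : Idx)
    (k : VertexIdx) : pairing (rescaledWall t i) (vert (t * |t|) k) = 0 ↔ inc i k := by
  rw [← (value_nonpos_and_eq_zero_iff hs hs' i k).2]
  rcases k with j | j | f | ⟨f, k⟩ <;> exact pairing_eq_zero_iff

/-! ### Symmetries and the smallest faces -/

/-- The permutation of the sign vectors that swaps the first two signs. -/
def swapSgn₁ : Fin 8 → Fin 8 := ![0, 5, 4, 3, 2, 1, 6, 7]

/-- The permutation of the sign vectors that swaps the last two signs. -/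
def swapSgn₂ : Fin 8 → Fin 8 := ![0, 3, 2, 1, 6, 5, 4, 7]

/-- The permutation of the sign vectors that changes the last sign. -/
def negSgn : Fin 8 → Fin 8 := ![3, 2, 1, 0, 5, 4, 7, 6]

/-- The action on the walls of a signed permutation of the coordinates. -/
def wallMap (π : Fin 8 → Fin 8) (ρ : Fin 6 → Fin 6) : Idx → Idx
  | .inl e => .inl (π e)
  | .inr (.inl e) => .inr (.inl (π e))
  | .inr (.inr l) => .inr (.inr (ρ l))

/-- The action of `swapSgn₁` on the walls. -/
def swapWall₁ : Idx → Idx := wallMap swapSgn₁ ![1, 0, 2, 3, 5, 4]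

/-- The action of `swapSgn₂` on the walls. -/
def swapWall₂ : Idx → Idx := wallMap swapSgn₂ ![0, 2, 1, 4, 3, 5]

/-- The action of `negSgn` on the walls. -/
def negWall : Idx → Idx := wallMap negSgn ![0, 1, 3, 2, 4, 5]

/-- The action on the vertices of a signed permutation of the coordinates. -/
def vertexMap (α : Fin 2 → Fin 2) (β : Fin 12 → Fin 12) (π : Fin 8 → Fin 8) (τ : Fin 3 → Fin 3) :
    VertexIdx → VertexIdx
  | .inl j => .inl (α j)
  | .inr (.inl j) => .inr (.inl (β j))
  | .inr (.inr (.inl e)) => .inr (.inr (.inl (π e)))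
  | .inr (.inr (.inr (e, i))) => .inr (.inr (.inr (π e, τ i)))

/-- The action of `swapSgn₁` on the vertices. -/
def swapVertex₁ : VertexIdx → VertexIdx :=
  vertexMap id ![0, 2, 1, 3, 8, 9, 10, 11, 4, 5, 6, 7] swapSgn₁ ![1, 0, 2]

/-- The action of `swapSgn₂` on the vertices. -/
def swapVertex₂ : VertexIdx → VertexIdx :=
  vertexMap id ![4, 5, 6, 7, 0, 1, 2, 3, 8, 10, 9, 11] swapSgn₂ ![0, 2, 1]

/-- The action of `negSgn` on the vertices. -/
def negVertex : VertexIdx → VertexIdx :=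
  vertexMap ![1, 0] ![0, 1, 2, 3, 5, 4, 7, 6, 9, 8, 11, 10] negSgn id

theorem inc_swap₁ : ∀ i k, inc (swapWall₁ i) (swapVertex₁ k) = inc i k := by
  decide +kernel

theorem inc_swap₂ : ∀ i k, inc (swapWall₂ i) (swapVertex₂ k) = inc i k := by
  decide +kernel

theorem inc_neg : ∀ i k, inc (negWall i) (negVertex k) = inc i k := by
  decide +kernel

theorem swapWall₁_involutive : Function.Involutive swapWall₁ := by
  unfold Function.Involutive
  decide

theorem swapWall₂_involutive : Function.Involutive swapWall₂ := by
  unfold Function.Involutive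
  decide

theorem negWall_involutive : Function.Involutive negWall := by
  unfold Function.Involutive
  decide

/-- A permutation of the coordinates preserves `η`, hence `w` is kept. A single sign change reverses
`η`, which is why `form_neg` reverses `w` as well. -/
theorem form_swap₁ (s : ℝ) (i : Idx) (h a b c w : ℝ) :
    form s (swapWall₁ i) h b a c w = form s i h a b c w := by
  rcases i with e | e | l
  · fin_cases e <;> simp [form, swapWall₁, wallMap, swapSgn₁, sgn, eta] <;> ring
  · fin_cases e <;> simp [form, swapWall₁, wallMap, swapSgn₁, sgn, eta] <;> ring
  · fin_cases l <;> simp [form, swapWall₁, wallMap, letterSgn, letterIdx]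

theorem form_swap₂ (s : ℝ) (i : Idx) (h a b c w : ℝ) :
    form s (swapWall₂ i) h a c b w = form s i h a b c w := by
  rcases i with e | e | l
  · fin_cases e <;> simp [form, swapWall₂, wallMap, swapSgn₂, sgn, eta] <;> ring
  · fin_cases e <;> simp [form, swapWall₂, wallMap, swapSgn₂, sgn, eta] <;> ring
  · fin_cases l <;> simp [form, swapWall₂, wallMap, letterSgn, letterIdx]

theorem form_neg (s : ℝ) (i : Idx) (h a b c w : ℝ) :
    form s (negWall i) h a b (-c) (-w) = form s i h a b c w := by
  rcases i with e | e | l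
  · fin_cases e <;> simp [form, negWall, wallMap, negSgn, sgn, eta]
  · fin_cases e <;> simp [form, negWall, wallMap, negSgn, sgn, eta]
  · fin_cases l <;> simp [form, negWall, wallMap, letterSgn, letterIdx]

/-- The conditions that all 22 forms are nonpositive at a point. -/
def InCone (s h a b c w : ℝ) : Prop := ∀ i, form s i h a b c w ≤ 0

theorem InCone.swap₁ {s h a b c w : ℝ} (hf : InCone s h a b c w) : InCone s h b a c w := by
  intro i
  rw [← swapWall₁_involutive i, form_swap₁]
  exact hf _

theorem InCone.swap₂ {s h a b c w : ℝ} (hf : InCone s h a b c w) : InCone s h a c b w := by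
  intro i
  rw [← swapWall₂_involutive i, form_swap₂]
  exact hf _

theorem InCone.neg {s h a b c w : ℝ} (hf : InCone s h a b c w) : InCone s h a b (-c) (-w) := by
  intro i
  rw [← negWall_involutive i, form_neg]
  exact hf _

/-- A property that is invariant under signed permutations, the sign changes acting on the last
coordinate as well, may be checked in a chamber. -/
theorem chamber_induction {p : ℝ → ℝ → ℝ → ℝ → Prop}
    (h₁ : ∀ a b c w, p b a c w → p a b c w) (h₂ : ∀ a b c w, p a c b w → p a b c w)
    (hn : ∀ a b c w, p a b (-c) (-w) → p a b c w)
    (h : ∀ a b c w, 0 ≤ c → c ≤ b → b ≤ a → p a b c w) (a b c w : ℝ) : p a b c w := by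
  have hp : ∀ a b c w, 0 ≤ a → 0 ≤ b → 0 ≤ c → p a b c w := by
    intro a b c w ha hb hc
    rcases le_total a b with hab | hab <;> rcases le_total b c with hbc | hbc <;>
      rcases le_total a c with hac | hac
    · exact h₁ _ _ _ _ (h₂ _ _ _ _ (h₁ _ _ _ _ (h _ _ _ _ ha hab hbc)))
    · exact h₁ _ _ _ _ (h₂ _ _ _ _ (h₁ _ _ _ _ (h _ _ _ _ ha hab hbc)))
    · exact h₁ _ _ _ _ (h₂ _ _ _ _ (h _ _ _ _ ha hac hbc))
    · exact h₁ _ _ _ _ (h _ _ _ _ hc hac hab)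
    · exact h₂ _ _ _ _ (h₁ _ _ _ _ (h _ _ _ _ hb hab hac))
    · exact h₂ _ _ _ _ (h _ _ _ _ hb hbc hac)
    · exact h _ _ _ _ hc hbc hab
    · exact h _ _ _ _ hc hbc hab
  have hp₃ : ∀ a b c w, 0 ≤ a → 0 ≤ b → p a b c w := by
    intro a b c w ha hb
    rcases le_total 0 c with hc | hc
    · exact hp a b c w ha hb hc
    · exact hn _ _ _ _ (hp _ _ _ _ ha hb (by linarith))
  have hp₂ : ∀ a b c w, 0 ≤ a → p a b c w := by
    intro a b c w ha
    rcases le_total 0 b with hb | hb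
    · exact hp₃ a b c w ha hb
    -- The sign change of `b` is that of `c` conjugated by the swap of the last two coordinates; the
    -- sign change of `a` below is obtained likewise.
    · exact h₂ _ _ _ _ (hn _ _ _ _ (h₂ _ _ _ _ (hp₃ _ _ _ _ ha (by linarith))))
  rcases le_total 0 a with ha | ha
  · exact hp₂ a b c w ha
  · exact h₁ _ _ _ _ (h₂ _ _ _ _ (hn _ _ _ _ (h₂ _ _ _ _ (h₁ _ _ _ _
      (hp₂ _ _ _ _ (by linarith))))))

theorem exists_inc_of_map {π : Idx → Idx} {ρ : VertexIdx → VertexIdx}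
    (hπ : Function.Involutive π) (hinc : ∀ i k, inc (π i) (ρ k) = inc i k) {f g : Idx → ℝ}
    (hfg : ∀ i, g (π i) = f i) (h : ∃ k, ∀ i, g i = 0 → inc i k) :
    ∃ k, ∀ i, f i = 0 → inc i k := by
  obtain ⟨k, hk⟩ := h
  refine ⟨ρ k, fun i hi => ?_⟩
  rw [← hπ i, hinc]
  exact hk _ (by rw [hfg, hi])

/-- The inequalities that define the cone in the chamber. -/
theorem InCone.chamber {s h a b c w : ℝ} (hf : InCone s h a b c w) :
    a ≤ h ∧ a + b + c + w ≤ 2 * h ∧ a + b - c - w ≤ 2 * h ∧ a + b + c - s * w ≤ 2 * h := by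
  have h1 := hf (.inr (.inr 0))
  have h2 := hf (.inl 0)
  have h3 := hf (.inl 3)
  have h4 := hf (.inr (.inl 0))
  simp [form, sgn, eta, letterSgn, letterIdx] at h1 h2 h3 h4
  refine ⟨?_, ?_, ?_, ?_⟩ <;> linarith

theorem inc_of_cases {f : Idx → ℝ} {k : VertexIdx}
    (h : ∀ i, inc i k = false → f i < 0) (i : Idx) (hi : f i = 0) : inc i k := by
  by_contra hk
  exact (h i (by simpa using hk)).ne hi

/-- Since `|s| < 1`, the sign of `w` decides which walls can be tight. For `w > 0` these are the
`e⁺` with `η = 1`, and `A` if `a = h`. For `w < 0` they are the `e⁺` with `η = -1`, the wall `0⁻`,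
and `A` if `a = h`. The vertex is chosen to lie on all of them: on the axis or of type `(e, i)` when
`w > 0`; when `w < 0`, also of type `e`, since `0⁻` may be tight without `A`. For `w = 0` the ideal
vertex `(1, 1, 0)` serves. -/
theorem exists_inc_of_chamber {s h a b c w : ℝ} (hs : -1 < s) (hs' : s ≤ 1 / 3) (hh : 0 < h)
    (hf : InCone s h a b c w) (hc : 0 ≤ c) (hcb : c ≤ b) (hba : b ≤ a) :
    ∃ k, ∀ i, form s i h a b c w = 0 → inc i k := by
  obtain ⟨h1, h2, h3, h4⟩ := hf.chamber
  rcases lt_trichotomy w 0 with hw | rfl | hw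
  · have hsw : s * w < -w := by nlinarith
    have hsw' : w / 3 ≤ s * w := by nlinarith
    -- Adding `h3` and `h4` gives `2(a + b) - (w + s w) ≤ 4h`, where `w + s w < 0`; hence `a + b <
    -- 2h`.
    have hbh : b < h := by linarith
    rcases h1.lt_or_eq with hah | rfl
    -- For `a > 0` the wall `7⁺` is not tight, which leaves `0⁻, 1⁺, 3⁺, 5⁺`, the walls through the
    -- vertex of type `e = 0`. For `a = 0` all four `e⁺` with `η = -1` may be tight, but `0⁻` is
    -- not.
    · by_cases ha : a = 0
      · refine ⟨.inl 1, inc_of_cases ?_⟩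
        have hb : b = 0 := by linarith
        have hc : c = 0 := by linarith
        subst ha hb hc
        rintro (e | e | l) hi <;> [fin_cases e; fin_cases e; fin_cases l] <;>
          first
          | exact absurd hi (by decide)
          | simp [form, sgn, eta, letterSgn, letterIdx]; linarith
      · have ha : 0 < a := lt_of_le_of_ne (by linarith) (Ne.symm ha)
        refine ⟨.inr (.inr (.inl 0)), inc_of_cases ?_⟩
        rintro (e | e | l) hi <;> [fin_cases e; fin_cases e; fin_cases l] <;>
          first
          | exact absurd hi (by decide)
          | simp [form, sgn, eta, letterSgn, letterIdx]; linarith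
    · refine ⟨.inr (.inr (.inr (0, 0))), inc_of_cases ?_⟩
      rintro (e | e | l) hi <;> [fin_cases e; fin_cases e; fin_cases l] <;>
        first
        | exact absurd hi (by decide)
        | simp [form, sgn, eta, letterSgn, letterIdx]; linarith
  · have hch : c < h := by linarith
    refine ⟨.inr (.inl 0), inc_of_cases ?_⟩
    rintro (e | e | l) hi <;> [fin_cases e; fin_cases e; fin_cases l] <;>
      first
      | exact absurd hi (by decide)
      | simp [form, sgn, eta, letterSgn, letterIdx]; linarith
  · have hsw : -w < s * w := by nlinarith
    have hsw' : s * w ≤ w / 3 := by nlinarith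
    rcases h1.lt_or_eq with hah | rfl
    · refine ⟨.inl 0, inc_of_cases ?_⟩
      rintro (e | e | l) hi <;> [fin_cases e; fin_cases e; fin_cases l] <;>
        first
        | exact absurd hi (by decide)
        | simp [form, sgn, eta, letterSgn, letterIdx]; linarith
    · refine ⟨.inr (.inr (.inr (3, 0))), inc_of_cases ?_⟩
      rintro (e | e | l) hi <;> [fin_cases e; fin_cases e; fin_cases l] <;>
        first
        | exact absurd hi (by decide)
        | simp [form, sgn, eta, letterSgn, letterIdx]; linarith

theorem exists_inc_of_inCone {s h : ℝ} (hs : -1 < s) (hs' : s ≤ 1 / 3) (hh : 0 < h)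
    (a b c w : ℝ) : InCone s h a b c w → ∃ k, ∀ i, form s i h a b c w = 0 → inc i k := by
  refine chamber_induction (p := fun a b c w => InCone s h a b c w →
    ∃ k, ∀ i, form s i h a b c w = 0 → inc i k) ?_ ?_ ?_ ?_ a b c w
  · exact fun a b c w ih hf => exists_inc_of_map swapWall₁_involutive inc_swap₁
      (fun i => form_swap₁ s i h a b c w) (ih hf.swap₁)
  · exact fun a b c w ih hf => exists_inc_of_map swapWall₂_involutive inc_swap₂
      (fun i => form_swap₂ s i h a b c w) (ih hf.swap₂)
  · exact fun a b c w ih hf => exists_inc_of_map negWall_involutive inc_neg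
      (fun i => form_neg s i h a b c w) (ih hf.neg)
  · exact fun a b c w hc hcb hba hf => exists_inc_of_chamber hs hs' hh hf hc hcb hba

/-- The coordinate `h` is positive on the cone, except at the origin. -/
theorem InCone.eq_zero_or_pos {s h : ℝ} (a b c w : ℝ) : InCone s h a b c w →
    0 < h ∨ (h = 0 ∧ a = 0 ∧ b = 0 ∧ c = 0 ∧ w = 0) := by
  refine chamber_induction (p := fun a b c w => InCone s h a b c w →
    0 < h ∨ (h = 0 ∧ a = 0 ∧ b = 0 ∧ c = 0 ∧ w = 0)) ?_ ?_ ?_ ?_ a b c w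
  · exact fun a b c w ih hf => (ih hf.swap₁).imp id (by tauto)
  · exact fun a b c w ih hf => (ih hf.swap₂).imp id (by tauto)
  · exact fun a b c w ih hf => (ih hf.neg).imp id (by simp)
  · intro a b c w hc hcb hba hf
    obtain ⟨h1, h2, h3, -⟩ := hf.chamber
    rcases (show 0 ≤ h by linarith).lt_or_eq with h0 | h0
    · exact Or.inl h0
    · right
      refine ⟨?_, ?_, ?_, ?_, ?_⟩ <;> linarith

/-! ### The domains `X t` -/

theorem sign_mul_sq (t : ℝ) : Real.sign t * t ^ 2 = t * |t| := by
  rcases lt_trichotomy t 0 with h | rfl | h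
  · rw [Real.sign_of_neg h, abs_of_neg h]; ring
  · simp
  · rw [Real.sign_of_pos h, abs_of_pos h]; ring

theorem q_point (t h a b c w : ℝ) :
    q t (point h a b c w) = a ^ 2 + b ^ 2 + c ^ 2 + t * |t| * w ^ 2 - 2 * h ^ 2 := by
  have h2 : √2 ^ 2 = 2 := Real.sq_sqrt (by norm_num)
  simp [q, point, sign_mul_sq, mul_pow, h2]
  ring

theorem q_smul (t c : ℝ) (x : V) : q t (c • x) = c ^ 2 * q t x := by
  simp only [q, Pi.smul_apply, smul_eq_mul]
  ring

theorem continuous_q (t : ℝ) : Continuous (q t) := by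
  unfold q
  fun_prop

theorem q_smul_neg {t : ℝ} (x : V) (c : ℝ) (hc : 0 < c) (h : q t x < 0) : q t (c • x) < 0 := by
  rw [q_smul]
  exact mul_neg_of_pos_of_neg (by positivity) h

theorem q_and_pos_smul {t : ℝ} (x : V) (c : ℝ) (hc : 0 < c) (h : q t x < 0 ∧ 0 < x 0) :
    q t (c • x) < 0 ∧ 0 < (c • x) 0 :=
  ⟨q_smul_neg x c hc h.1, mul_pos hc h.2⟩

theorem X_of_neg {t : ℝ} (ht : t < 0) : X t = projSet fun x => q t x < 0 := by
  rw [X, if_neg ht.not_gt, if_neg ht.ne]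

/-- At `t = 0` the condition `q < 0` excludes `x₀ = 0`, so `0 ≤ x₀` and `0 < x₀` define the same
set. -/
theorem X_of_nonneg {t : ℝ} (ht : 0 ≤ t) : X t = projSet fun x => q t x < 0 ∧ 0 < x 0 := by
  rcases ht.eq_or_lt with rfl | ht
  · rw [X, if_neg (lt_irrefl _), if_pos rfl]
    congr 1
    ext x
    refine and_congr_right fun hq => ⟨fun h => h.lt_of_ne' fun h0 => ?_, le_of_lt⟩
    simp only [q, h0, Real.sign_zero] at hq
    nlinarith [sq_nonneg (x 1), sq_nonneg (x 2), sq_nonneg (x 3)]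
  · rw [X, if_pos ht]

theorem isOpen_X (t : ℝ) : IsOpen (X t) := by
  rcases lt_or_ge t 0 with ht | ht
  · rw [X_of_neg ht]
    exact isOpen_projSet q_smul_neg (isOpen_lt (continuous_q t) continuous_const)
  · rw [X_of_nonneg ht]
    exact isOpen_projSet q_and_pos_smul ((isOpen_lt (continuous_q t) continuous_const).inter
      (isOpen_lt continuous_const (continuous_apply 0)))

theorem cls_mem_X_iff {t : ℝ} (x : {x : V // x ≠ 0}) (h0 : 0 < x.1 0) :
    cls x ∈ X t ↔ q t x.1 < 0 := by
  rcases lt_or_ge t 0 with ht | ht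
  · rw [X_of_neg ht, cls_mem_projSet q_smul_neg]
  · rw [X_of_nonneg ht, cls_mem_projSet q_and_pos_smul, and_iff_left h0]

/-- The cone over a subset of `S⁴`. -/
def coneOver (U : Set S4) : Set V := Subtype.val '' (cls ⁻¹' U)

theorem isOpen_coneOver {U : Set S4} (hU : IsOpen U) : IsOpen (coneOver U) :=
  (isOpen_ne (x := (0 : V))).isOpenMap_subtype_val _ (hU.preimage continuous_cls)

theorem mem_coneOver {U : Set S4} (x : {x : V // x ≠ 0}) : x.1 ∈ coneOver U ↔ cls x ∈ U := by
  simp [coneOver, x.2]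

/-- Increasing a positive `x₀` strictly decreases `q t`, so the point is a limit of points with `q t
< 0`. -/
theorem cls_mem_closure_X {t : ℝ} (x : {x : V // x ≠ 0}) (h0 : 0 < x.1 0) (hq : q t x.1 ≤ 0) :
    cls x ∈ closure (X t) := by
  rw [mem_closure_iff]
  intro U hU hx
  set γ : ℝ → V := fun δ => Function.update x.1 0 (x.1 0 + δ) with hγ
  have hγc : Continuous γ := by
    fun_prop
  have hγ0 : γ 0 = x.1 := by simp [hγ]
  have hev : ∀ᶠ δ in 𝓝 (0 : ℝ), γ δ ∈ coneOver U :=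
    hγc.continuousAt.eventually_mem ((isOpen_coneOver hU).mem_nhds (by
      rw [hγ0]; exact (mem_coneOver x).2 hx))
  obtain ⟨δ, hδU, hδ⟩ :=
    ((hev.filter_mono nhdsWithin_le_nhds).and (self_mem_nhdsWithin (s := Ioi (0 : ℝ)))).exists
  obtain ⟨y, hyU, hy⟩ := hδU
  have hδ : 0 < δ := hδ
  refine ⟨cls y, hyU, (cls_mem_X_iff y ?_).2 ?_⟩
  · rw [hy]; simp [hγ]; linarith
  · rw [hy]
    simp only [q] at hq ⊢
    simp [hγ]
    nlinarith

theorem InCone.q_nonpos {s h : ℝ} (hs : -1 < s) (hs' : s ≤ 1 / 3) (a b c w : ℝ) :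
    InCone s h a b c w → a ^ 2 + b ^ 2 + c ^ 2 + s * w ^ 2 - 2 * h ^ 2 ≤ 0 := by
  refine chamber_induction (p := fun a b c w => InCone s h a b c w →
    a ^ 2 + b ^ 2 + c ^ 2 + s * w ^ 2 - 2 * h ^ 2 ≤ 0) ?_ ?_ ?_ ?_ a b c w
  · exact fun a b c w ih hf => by linarith [ih hf.swap₁]
  · exact fun a b c w ih hf => by linarith [ih hf.swap₂]
  · exact fun a b c w ih hf => by linarith [ih hf.neg, neg_sq c, neg_sq w]
  intro a b c w hc hcb hba hf
  obtain ⟨h1, h2, h3, h4⟩ := hf.chamber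
  have hb : 0 ≤ b := hc.trans hcb
  have ha : 0 ≤ a := hb.trans hba
  have hh : 0 ≤ h := ha.trans h1
  -- Each of `a, b, c` lies in `[0, h]`.
  have hsq : a ^ 2 + b ^ 2 + c ^ 2 ≤ h * (a + b + c) := by nlinarith
  rcases le_or_gt 0 w with hw | hw
  · have h5 : s * w ^ 2 ≤ h * w := by
      have : s * w ≤ h := by nlinarith
      nlinarith
    nlinarith
  rcases le_or_gt s 0 with hs0 | hs0
  · have h5 : s * w ^ 2 ≤ 0 := mul_nonpos_of_nonpos_of_nonneg hs0 (sq_nonneg w)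
    rcases le_or_gt (a + b + c) (2 * h) with hm | hm
    · nlinarith
    · have h6 : s * w ^ 2 ≤ (a + b + c - 2 * h) * w := by nlinarith
      -- With `d = a + b + c - 2h > 0`, `h4` gives `d ≤ s w ≤ -w`, hence `s w² ≤ d w ≤ -d²`.
      have h7 : a + b + c - 2 * h ≤ -w := by nlinarith
      have h8 : s * w ^ 2 ≤ -(a + b + c - 2 * h) ^ 2 := by nlinarith
      -- With `p, q, r` the differences `h - a, h - b, h - c`, one has `a² + b² + c² - d² = 2h² -
      -- 2(pq + pr + qr)`.
      have e1 := mul_nonneg (sub_nonneg.2 h1) (sub_nonneg.2 (hba.trans h1))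
      have e2 := mul_nonneg (sub_nonneg.2 h1) (sub_nonneg.2 (hcb.trans (hba.trans h1)))
      have e3 := mul_nonneg (sub_nonneg.2 (hba.trans h1)) (sub_nonneg.2 (hcb.trans (hba.trans h1)))
      nlinarith
  · have hsw : s * w ≤ 0 := (mul_neg_of_pos_of_neg hs0 hw).le
    rcases le_or_gt (-w) h with hm | hm
    · have h5 : s * w * (h + w) ≤ 0 := mul_nonpos_of_nonpos_of_nonneg hsw (by linarith)
      nlinarith
    -- By `h3` and `c ≤ b`, each of `a, b, c` is at most `2h + w`, which now improves on the bound
    -- `h`.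
    · have h5 : a ^ 2 + b ^ 2 + c ^ 2 ≤ (2 * h + w) * (a + b + c) := by nlinarith
      have h6 : (2 * h + w) * (a + b + c) ≤ (2 * h + w) * (2 * h + s * w) :=
        mul_le_mul_of_nonneg_left (by linarith) (by linarith)
      have h7 : 0 ≤ h + s * w := by nlinarith
      -- This is half the remaining estimate: `(2h + w)(2h + s w) + s w² - 2h² = 2(h + w)(h + s w)`.
      have h8 : (h + w) * (h + s * w) ≤ 0 := mul_nonpos_of_nonpos_of_nonneg (by linarith) h7
      nlinarith

/-! ### The rescaled polytope -/

theorem mul_abs_mem_Ioc {t : ℝ} (ht : t ∈ Ioc (-1 : ℝ) (1 / √3)) :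
    -1 < t * |t| ∧ t * |t| ≤ 1 / 3 := by
  have h3 : (1 / √3) ^ 2 = 1 / 3 := by rw [div_pow, Real.sq_sqrt (by norm_num)]; norm_num
  rcases le_total 0 t with h | h
  · rw [abs_of_nonneg h]
    exact ⟨by nlinarith, by nlinarith [ht.2]⟩
  · rw [abs_of_nonpos h]
    exact ⟨by nlinarith [ht.1], by nlinarith⟩

theorem isGeneratedBy_vert {t : ℝ} (hs : -1 < t * |t|) (hs' : t * |t| ≤ 1 / 3) :
    IsGeneratedBy (rescaledWall t) (vert (t * |t|)) where
  ne_zero k := by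
    intro h
    have h0 : vert (t * |t|) k 0 = 0 := by rw [h]; rfl
    rcases k with j | j | f | ⟨f, k⟩ <;> simp [vert, point] at h0
    linarith
  nonpos := pairing_vert_nonpos hs hs'
  exists_sum := by
    refine exists_sum_of_exists_tight (fun k => ?_) (pairing_vert_nonpos hs hs') fun x hx0 hx => ?_
    · have : ∀ k, ∃ i, inc i k = false := by decide +kernel
      obtain ⟨i, hi⟩ := this k
      refine ⟨i, (pairing_vert_nonpos hs hs' i k).lt_of_ne fun h => ?_⟩
      rw [pairing_vert_eq_zero_iff hs hs', hi] at h
      exact Bool.false_ne_true h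
    · obtain ⟨h, a, b, c, w, rfl⟩ := exists_eq_point x
      have hf : InCone (t * |t|) h a b c w := fun i => pairing_nonpos_iff.1 (hx i)
      have hh : 0 < h := by
        refine (hf.eq_zero_or_pos).resolve_right ?_
        rintro ⟨rfl, rfl, rfl, rfl, rfl⟩
        exact hx0 (by ext i; fin_cases i <;> simp [point])
      obtain ⟨k, hk⟩ := exists_inc_of_inCone hs hs' hh a b c w hf
      exact ⟨k, fun i hi =>
        (pairing_vert_eq_zero_iff hs hs' i k).2 (hk i (pairing_eq_zero_iff.1 hi))⟩
  exists_neg := by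
    refine ⟨point 1 0 0 0 0, fun h => ?_, fun i => pairing_neg_iff.2 ?_⟩
    · have := congrFun h 0
      simp [point] at this
    · rcases i with e | e | l
      · simp [form]
      · simp [form]
      · simp only [form]
        generalize letterIdx l = i
        fin_cases i <;> simp

/-- Dividing `x₄` by `|t|` turns the forms `e⁺` into `|t|⁻¹` times the original ones, and `t|t| ·
x₄/|t| = t x₄` accounts for the forms `e⁻`; the walls `A, …, F` do not involve `x₄`. -/
theorem exists_pos_pairing_piCongrRight {t : ℝ} (ht : |t| ≠ 0) (i : Idx) :
    ∃ r : ℝ, 0 < r ∧ ∀ x : V, pairing (rescaledWall t i)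
      ((LinearEquiv.piCongrRight fun i : Fin 5 =>
        if i = 4 then LinearEquiv.smulOfNeZero ℝ ℝ |t|⁻¹ (inv_ne_zero ht)
        else LinearEquiv.refl ℝ ℝ) x) = r * pairing (wall t i) x := by
  rcases i with e | e | l
  · refine ⟨|t|⁻¹, inv_pos.2 (lt_of_le_of_ne (abs_nonneg t) ht.symm), fun x => ?_⟩
    fin_cases e <;>
      simp [pairing, rescaledWall, rescaledPlus, wall, wallPlus, Fin.sum_univ_five] <;>
      field_simp
  · refine ⟨1, one_pos, fun x => ?_⟩
    fin_cases e <;>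
      simp [pairing, rescaledWall, rescaledMinus, wall, wallMinus, Fin.sum_univ_five] <;>
      field_simp
  · refine ⟨1, one_pos, fun x => ?_⟩
    fin_cases l <;> simp [pairing, rescaledWall, wallLetter, wall, Fin.sum_univ_five]

theorem rescaledPbar_eq (t : ℝ) : rescaledPbar t = ⋂ i, halfSpace (rescaledWall t i) := by
  unfold rescaledPbar
  split_ifs with h
  · rw [h]
  have ht := abs_ne_zero.2 h
  set D : V ≃ₗ[ℝ] V := LinearEquiv.piCongrRight fun i : Fin 5 =>
    if i = 4 then LinearEquiv.smulOfNeZero ℝ ℝ |t|⁻¹ (inv_ne_zero ht)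
    else LinearEquiv.refl ℝ ℝ with hD
  have hmap : ∀ x (hx : D x ≠ 0) (hx' : x ≠ 0), rescale |t| ht (cls ⟨x, hx'⟩) = cls ⟨D x, hx⟩ :=
    fun x hx hx' => rfl
  have hiff : ∀ x i, pairing (rescaledWall t i) (D x) ≤ 0 ↔ pairing (wall t i) x ≤ 0 := by
    intro x i
    obtain ⟨r, hr, hf⟩ := exists_pos_pairing_piCongrRight ht i
    rw [hD, hf]
    exact ⟨fun hle => nonpos_of_mul_nonpos_right hle hr, mul_nonpos_of_nonneg_of_nonpos hr.le⟩
  ext p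
  constructor
  · rintro ⟨y, hy, rfl⟩
    obtain ⟨⟨x, hx⟩, rfl⟩ := cls_surjective y
    have hDx : D x ≠ 0 := by simpa using hx
    rw [hmap x hDx hx, cls_mem_iInter_halfSpace]
    exact fun i => (hiff x i).2 ((cls_mem_iInter_halfSpace _).1 hy i)
  · intro hp
    obtain ⟨⟨y, hy⟩, rfl⟩ := cls_surjective p
    obtain ⟨x, rfl⟩ := D.surjective y
    have hx : x ≠ 0 := fun h => hy (by rw [h, map_zero])
    exact ⟨cls ⟨x, hx⟩, (cls_mem_iInter_halfSpace _).2 fun i =>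
      (hiff x i).1 ((cls_mem_iInter_halfSpace _).1 hp i), hmap x hy hx⟩

theorem isPolytope_of_exists_neg {I : Type*} [Fintype I] {ℓ : I → V}
    (h : ∃ x, x ≠ 0 ∧ ∀ i, pairing (ℓ i) x < 0) : IsPolytope (⋂ i, halfSpace (ℓ i)) := by
  classical
  refine ⟨⟨Finset.univ.image ℓ, fun α hα => ?_, by simp⟩,
    interior_iInter_halfSpace_nonempty h⟩
  rintro rfl
  obtain ⟨o, -, ho⟩ := h
  obtain ⟨i, -, hi⟩ := Finset.mem_image.1 hα
  have := ho i
  rw [hi, zero_pairing] at this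
  exact this.ne rfl

theorem iInter_halfSpace_subset {t : ℝ} (hs : -1 < t * |t|) (hs' : t * |t| ≤ 1 / 3) :
    ⋂ i, halfSpace (rescaledWall t i) ⊆ closure (X t) ∩ affineChart := by
  intro p hp
  obtain ⟨⟨x, hx⟩, rfl⟩ := cls_surjective p
  rw [cls_mem_iInter_halfSpace] at hp
  obtain ⟨h, a, b, c, w, rfl⟩ := exists_eq_point x
  have hf : InCone (t * |t|) h a b c w := fun i => pairing_nonpos_iff.1 (hp i)
  have hh : 0 < h := by
    refine (hf.eq_zero_or_pos).resolve_right ?_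
    rintro ⟨rfl, rfl, rfl, rfl, rfl⟩
    exact hx (by ext i; fin_cases i <;> simp [point])
  have h0 : 0 < point h a b c w 0 := mul_pos (by positivity) hh
  refine ⟨cls_mem_closure_X _ h0 ?_, ⟨_, h0, rfl⟩⟩
  rw [q_point]
  exact hf.q_nonpos hs hs'

/-! ### Irredundancy of the walls -/

theorem exists_point_form {s : ℝ} (hs : -1 < s) (hs' : s ≤ 1 / 3) (i : Idx) :
    ∃ a b c w, 0 < form s i 1 a b c w ∧ ∀ j, j ≠ i → form s j 1 a b c w ≤ 0 := by
  rcases i with e | e | l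
  -- This `d` puts the point on `e⁻`, since `3d - s - 2 = 0`, while the value of `e⁺` is `3d - 1 = 1
  -- + s > 0`.
  · set d : ℝ := (2 + s) / 3 with hd
    have hp : ∀ f : Fin 8, form s (.inl f) 1 (d * sgn e 0) (d * sgn e 1) (d * sgn e 2) (eta e)
        = d * (sgnProd f e : ℤ) + (eta f * eta e : ℤ) - 2 := by
      intro f; simp only [form, sgnProd]; push_cast; ring
    refine ⟨d * sgn e 0, d * sgn e 1, d * sgn e 2, eta e, ?_, ?_⟩
    · rw [hp]
      rcases sgnProd_cases e e with ⟨h0, h1, h2⟩ | ⟨h0, -⟩ | ⟨h0, -⟩ | ⟨h0, -⟩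
      · rw [h1, h2]; push_cast; linarith
      all_goals exact absurd rfl h0
    · rintro (f | f | l) hj
      · rw [hp]
        rcases sgnProd_cases f e with ⟨rfl, -⟩ | ⟨-, h1, h2⟩ | ⟨-, h1, h2⟩ | ⟨-, h1, h2⟩
        · exact absurd rfl hj
        all_goals rw [h1, h2]; push_cast; linarith
      · have : form s (.inr (.inl f)) 1 (d * sgn e 0) (d * sgn e 1) (d * sgn e 2) (eta e)
            = d * (sgnProd f e : ℤ) - s * (eta f * eta e : ℤ) - 2 := by
          simp only [form, sgnProd]; push_cast; ring
        rw [this]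
        rcases sgnProd_cases f e with ⟨-, h1, h2⟩ | ⟨-, h1, h2⟩ | ⟨-, h1, h2⟩ | ⟨-, h1, h2⟩
        all_goals rw [h1, h2]; push_cast; linarith
      · have : form s (.inr (.inr l)) 1 (d * sgn e 0) (d * sgn e 1) (d * sgn e 2) (eta e)
            = d * (letterSgn l * sgn e (letterIdx l) : ℤ) - 1 := by
          simp only [form]
          push_cast
          generalize letterIdx l = i
          fin_cases i <;> simp <;> ring
        rw [this]
        rcases letter_sgn_cases l e (letterIdx l) with h | h
        all_goals rw [h]; push_cast; linarith
  · have hp : ∀ f : Fin 8, form s (.inr (.inl f)) 1 (sgn e 0) (sgn e 1) (sgn e 2) (-eta e)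
        = (sgnProd f e : ℤ) + s * (eta f * eta e : ℤ) - 2 := by
      intro f; simp only [form, sgnProd]; push_cast; ring
    -- A corner of the cube bounded by the lettered walls: `e⁻` takes the value `1 + s > 0`, while
    -- `e⁺` and its three neighbours `f⁺` vanish.
    refine ⟨sgn e 0, sgn e 1, sgn e 2, -eta e, ?_, ?_⟩
    · rw [hp]
      rcases sgnProd_cases e e with ⟨h0, h1, h2⟩ | ⟨h0, -⟩ | ⟨h0, -⟩ | ⟨h0, -⟩
      · rw [h1, h2]; push_cast; linarith
      all_goals exact absurd rfl h0
    · rintro (f | f | l) hj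
      · have : form s (.inl f) 1 (sgn e 0) (sgn e 1) (sgn e 2) (-eta e)
            = (sgnProd f e : ℤ) - (eta f * eta e : ℤ) - 2 := by
          simp only [form, sgnProd]; push_cast; ring
        rw [this]
        rcases sgnProd_cases f e with ⟨-, h1, h2⟩ | ⟨-, h1, h2⟩ | ⟨-, h1, h2⟩ | ⟨-, h1, h2⟩
        all_goals rw [h1, h2]; push_cast; linarith
      · rw [hp]
        rcases sgnProd_cases f e with ⟨rfl, -⟩ | ⟨-, h1, h2⟩ | ⟨-, h1, h2⟩ | ⟨-, h1, h2⟩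
        · exact absurd rfl hj
        all_goals rw [h1, h2]; push_cast; linarith
      · have : form s (.inr (.inr l)) 1 (sgn e 0) (sgn e 1) (sgn e 2) (-eta e)
            = (letterSgn l * sgn e (letterIdx l) : ℤ) - 1 := by
          simp only [form]
          push_cast
          generalize letterIdx l = i
          fin_cases i <;> simp
        rw [this]
        rcases letter_sgn_cases l e (letterIdx l) with h | h
        all_goals rw [h]; push_cast; linarith
  -- The point lies on the coordinate axis of the wall; `3/2` is beyond that wall at `1`, but short
  -- of `2`, where the walls `e^±` are reached.
  · set x : Fin 3 → ℝ := fun j => if j = letterIdx l then 3 / 2 * letterSgn l else 0 with hx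
    have hp : ∀ m : Fin 6, form s (.inr (.inr m)) 1 (x 0) (x 1) (x 2) 0
        = letterSgn m * x (letterIdx m) - 1 := by
      intro m
      simp only [form]
      generalize letterIdx m = i
      fin_cases i <;> simp
    have he : ∀ f : Fin 8, (sgn f 0 : ℝ) * x 0 + sgn f 1 * x 1 + sgn f 2 * x 2
        = 3 / 2 * (letterSgn l * sgn f (letterIdx l) : ℤ) := by
      intro f
      simp only [hx]
      push_cast
      generalize letterIdx l = i
      fin_cases i <;> simp <;> ring
    have hsq : ∀ m, letterSgn m * letterSgn m = 1 := by decide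
    have hne : ∀ m l, m ≠ l → letterIdx m = letterIdx l → letterSgn m * letterSgn l = -1 := by
      decide
    refine ⟨x 0, x 1, x 2, 0, ?_, ?_⟩
    · have h : (letterSgn l : ℝ) * letterSgn l = 1 := by exact_mod_cast hsq l
      rw [hp]
      simp only [hx, if_true]
      linarith
    · rintro (f | f | m) hj
      · simp only [form, he, mul_zero]
        rcases letter_sgn_cases l f (letterIdx l) with h | h
        all_goals rw [h]; norm_num
      · simp only [form, he, mul_zero]
        rcases letter_sgn_cases l f (letterIdx l) with h | h
        all_goals rw [h]; norm_num
      · have hml : m ≠ l := fun h => hj (by rw [h])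
        rw [hp]
        by_cases hm : letterIdx m = letterIdx l
        · have h : (letterSgn m : ℝ) * letterSgn l = -1 := by exact_mod_cast hne m l hml hm
          simp only [hx, hm, if_true]
          linarith
        · simp [hx, hm]

theorem point_one_ne_zero (a b c w : ℝ) : point 1 a b c w ≠ 0 := fun h => by
  have := congrFun h 0
  simp [point] at this

theorem exists_not_mem_halfSpace {t : ℝ} (hs : -1 < t * |t|) (hs' : t * |t| ≤ 1 / 3) (i : Idx) :
    ∃ p, p ∉ halfSpace (rescaledWall t i) ∧ ∀ j, j ≠ i → p ∈ halfSpace (rescaledWall t j) := by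
  obtain ⟨a, b, c, w, hi, hj⟩ := exists_point_form hs hs' i
  refine ⟨cls ⟨point 1 a b c w, point_one_ne_zero a b c w⟩, ?_, fun j hji => ?_⟩
  · rw [cls_mem_halfSpace, pairing_nonpos_iff]
    exact hi.not_ge
  · rw [cls_mem_halfSpace, pairing_nonpos_iff]
    exact hj j hji

/-! ### Ideal and finite vertices -/

/-- The vertices on the frontier of `X t`. -/
def isIdeal : VertexIdx → Bool
  | .inr (.inl _) => true
  | _ => false

/-- The values of the quadratic form are `4s - 2` on the axis, `2(s + 1)(5s - 3)` for the vertices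
of type `e`, and `2(s² - 1)` for those of type `(e, i)`. -/
theorem q_vert_neg {t : ℝ} (hs : -1 < t * |t|) (hs' : t * |t| ≤ 1 / 3) {k : VertexIdx}
    (hk : isIdeal k = false) : q t (vert (t * |t|) k) < 0 := by
  have hsgn : ∀ (e : Fin 8) (i : Fin 3), sgn e i ^ 2 = 1 := by decide
  have hsgn : ∀ (e : Fin 8) (i : Fin 3), (sgn e i : ℝ) ^ 2 = 1 := fun e i => by
    exact_mod_cast hsgn e i
  have heta : ∀ e : Fin 8, (eta e : ℝ) ^ 2 = 1 := fun e => by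
    simp [eta, mul_pow, hsgn]
  have haxis : ∀ j : Fin 2, axisSgn j ^ 2 = 1 := by decide
  rcases k with j | j | f | ⟨f, k⟩
  · have haxis : (axisSgn j : ℝ) ^ 2 = 1 := by exact_mod_cast haxis j
    rw [vert, q_point]
    simp only [mul_pow, haxis]
    linarith
  · simp [isIdeal] at hk
  · rw [vert, q_point]
    simp only [mul_pow, hsgn, heta]
    nlinarith
  · rw [vert, q_point]
    simp only [mul_pow, hsgn, heta]
    fin_cases k <;> simp [edgeCoord] <;> nlinarith

theorem q_vert_of_isIdeal {t : ℝ} {k : VertexIdx} (hk : isIdeal k = true) :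
    q t (vert (t * |t|) k) = 0 := by
  have hsq : ∀ j : Fin 12, idealCoord j 0 ^ 2 + idealCoord j 1 ^ 2 + idealCoord j 2 ^ 2 = 2 := by
    decide
  rcases k with j | j | f | ⟨f, k⟩
  · simp [isIdeal] at hk
  · have hsq : ((idealCoord j 0 ^ 2 + idealCoord j 1 ^ 2 + idealCoord j 2 ^ 2 : ℤ) : ℝ) = 2 := by
      exact_mod_cast hsq j
    push_cast at hsq
    rw [vert, q_point, hsq]
    ring
  · simp [isIdeal] at hk
  · simp [isIdeal] at hk

theorem vert_zero_pos {s : ℝ} (hs' : s ≤ 1 / 3) (k : VertexIdx) : 0 < vert s k 0 := by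
  rcases k with j | j | f | ⟨f, k⟩
  · exact mul_pos (by positivity) one_pos
  · exact mul_pos (by positivity) one_pos
  · exact mul_pos (by positivity) (by linarith)
  · exact mul_pos (by positivity) two_pos

section Vertices

variable {t : ℝ} (hs : -1 < t * |t|) (hs' : t * |t| ≤ 1 / 3)
include hs hs'

/-- The vertices as points of the sphere. -/
def vertexPoint (k : VertexIdx) : S4 :=
  cls ⟨vert (t * |t|) k, (isGeneratedBy_vert hs hs').ne_zero k⟩

theorem eq_of_tight_imp (k l : VertexIdx)
    (h : ∀ i, pairing (rescaledWall t i) (vert (t * |t|) k) = 0 →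
      pairing (rescaledWall t i) (vert (t * |t|) l) = 0) : k = l :=
  eq_of_inc_imp k l fun i hi =>
    (pairing_vert_eq_zero_iff hs hs' i l).1 (h i ((pairing_vert_eq_zero_iff hs hs' i k).2 hi))

theorem vertexPoint_injective : Function.Injective (vertexPoint hs hs') :=
  (isGeneratedBy_vert hs hs').cls_injective (eq_of_tight_imp hs hs')

theorem vertices_rescaledPbar : vertices (rescaledPbar t) = range (vertexPoint hs hs') := by
  rw [rescaledPbar_eq]
  exact (isGeneratedBy_vert hs hs').vertices_eq (eq_of_tight_imp hs hs')

theorem vertexPoint_mem_X_iff (k : VertexIdx) :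
    vertexPoint hs hs' k ∈ X t ↔ isIdeal k = false := by
  rw [vertexPoint, cls_mem_X_iff _ (vert_zero_pos hs' k)]
  constructor
  · intro h
    by_contra hk
    exact h.ne (q_vert_of_isIdeal (by simpa using hk))
  · exact q_vert_neg hs hs'

theorem vertexPoint_mem_frontier_iff (k : VertexIdx) :
    vertexPoint hs hs' k ∈ frontier (X t) ↔ isIdeal k = true := by
  have hcl : vertexPoint hs hs' k ∈ closure (X t) :=
    (iInter_halfSpace_subset hs hs' ((isGeneratedBy_vert hs hs').cls_mem k)).1
  rw [(isOpen_X t).frontier_eq, Set.mem_sdiff, vertexPoint_mem_X_iff, Bool.not_eq_false]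
  exact and_iff_right hcl

theorem ncard_vertices : (vertices (rescaledPbar t)).ncard = 46 := by
  rw [vertices_rescaledPbar hs hs', ← image_univ,
    ncard_image_of_injective _ (vertexPoint_injective hs hs'), ncard_univ,
    Nat.card_eq_fintype_card]
  rfl

theorem ncard_image_filter (b : Bool) :
    (vertexPoint hs hs' '' {k | isIdeal k = b}).ncard =
      (Finset.univ.filter fun k => isIdeal k = b).card := by
  rw [ncard_image_of_injective _ (vertexPoint_injective hs hs'), ← ncard_coe_finset]
  simp

theorem ncard_vertices_inter_frontier :
    (vertices (rescaledPbar t) ∩ frontier (X t)).ncard = 12 := by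
  have : vertices (rescaledPbar t) ∩ frontier (X t) =
      vertexPoint hs hs' '' {k | isIdeal k = true} := by
    ext p
    rw [vertices_rescaledPbar hs hs']
    constructor
    · rintro ⟨⟨k, rfl⟩, hk⟩
      exact ⟨k, (vertexPoint_mem_frontier_iff hs hs' k).1 hk, rfl⟩
    · rintro ⟨k, hk, rfl⟩
      exact ⟨⟨k, rfl⟩, (vertexPoint_mem_frontier_iff hs hs' k).2 hk⟩
  rw [this, ncard_image_filter]
  decide

theorem ncard_vertices_inter_X : (vertices (rescaledPbar t) ∩ X t).ncard = 34 := by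
  have : vertices (rescaledPbar t) ∩ X t = vertexPoint hs hs' '' {k | isIdeal k = false} := by
    ext p
    rw [vertices_rescaledPbar hs hs']
    constructor
    · rintro ⟨⟨k, rfl⟩, hk⟩
      exact ⟨k, (vertexPoint_mem_X_iff hs hs' k).1 hk, rfl⟩
    · rintro ⟨k, hk, rfl⟩
      exact ⟨⟨k, rfl⟩, (vertexPoint_mem_X_iff hs hs' k).2 hk⟩
  rw [this, ncard_image_filter]
  decide

end Vertices

/-! ### Convergence -/

/-- Intersections of half-spaces that depend continuously on a parameter converge, if the limit
has an interior point. -/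
theorem convergesAtZero_iInter_halfSpace {I : Type*} [Fintype I] {ℓ : ℝ → I → V}
    (hℓ : ∀ i, Continuous fun t => ℓ t i) (hneg : ∃ x, x ≠ 0 ∧ ∀ i, pairing (ℓ 0 i) x < 0) :
    ConvergesAtZero fun t => ⋂ i, halfSpace (ℓ t i) := by
  have hcont : ∀ i, Continuous fun p : ℝ × V => pairing (ℓ p.1 i) p.2 := by
    intro i
    have hℓi : ∀ j, Continuous fun t => ℓ t i j := fun j => (continuous_apply j).comp (hℓ i)
    unfold pairing
    exact continuous_finsetSum _ fun j _ =>
      ((hℓi j).comp continuous_fst).mul ((continuous_apply j).comp continuous_snd)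
  constructor
  · intro U hU hKU
    -- A unit vector outside the cone over `U` violates some inequality at `t = 0`; compactness of
    -- the unit sphere makes this hold for all unit vectors at once when `t` is small.
    have hev : ∀ᶠ t in 𝓝 (0 : ℝ), ∀ x ∈ Metric.sphere (0 : V) 1,
        x ∈ coneOver U ∨ ∃ i, 0 < pairing (ℓ t i) x := by
      refine (isCompact_sphere (0 : V) 1).eventually_forall_of_forall_eventually fun x hx => ?_
      have hx0 : x ≠ 0 := by
        rintro rfl
        simp at hx
      by_cases hxi : ∀ i, pairing (ℓ 0 i) x ≤ 0
      · have hxU : x ∈ coneOver U :=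
          (mem_coneOver ⟨x, hx0⟩).2 (hKU ((cls_mem_iInter_halfSpace _).2 hxi))
        exact (continuous_snd.continuousAt.eventually_mem
          ((isOpen_coneOver hU).mem_nhds hxU)).mono fun p hp => Or.inl hp
      · push Not at hxi
        obtain ⟨i, hi⟩ := hxi
        exact (continuousAt_const.eventually_lt (hcont i).continuousAt hi).mono
          fun p hp => Or.inr ⟨i, hp⟩
    refine (hev.filter_mono nhdsWithin_le_nhds).mono fun t ht p hp => ?_
    obtain ⟨⟨x, hx⟩, rfl⟩ := cls_surjective p
    have hn : 0 < ‖x‖⁻¹ := inv_pos.2 (norm_pos_iff.2 hx)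
    have hy : ‖x‖⁻¹ • x ≠ 0 := smul_ne_zero hn.ne' hx
    have hxy : cls ⟨x, hx⟩ = cls ⟨‖x‖⁻¹ • x, hy⟩ := cls_eq_cls_iff.2 ⟨_, hn, rfl⟩
    rw [hxy] at hp ⊢
    refine (mem_coneOver ⟨_, hy⟩).1 ((ht _ ?_).resolve_right ?_)
    · simp [norm_smul, hx]
    · rintro ⟨i, hi⟩
      exact hi.not_ge ((cls_mem_iInter_halfSpace _).1 hp i)
  · rintro U hU ⟨p, hp, hpU⟩
    obtain ⟨x, rfl⟩ := cls_surjective p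
    obtain ⟨o, -, ho⟩ := hneg
    rw [cls_mem_iInter_halfSpace] at hp
    -- Moving the point slightly towards the interior vector `o` keeps it in `U` and makes all
    -- inequalities strict at `t = 0`, so that they persist for small `t`.
    have hγ : Continuous fun δ : ℝ => x.1 + δ • o := by fun_prop
    have hev : ∀ᶠ δ in 𝓝 (0 : ℝ), x.1 + δ • o ∈ coneOver U :=
      hγ.continuousAt.eventually_mem ((isOpen_coneOver hU).mem_nhds (by
        simpa using (mem_coneOver x).2 hpU))
    obtain ⟨δ, hδU, hδ⟩ :=
      ((hev.filter_mono nhdsWithin_le_nhds).and (self_mem_nhdsWithin (s := Ioi (0 : ℝ)))).exists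
    obtain ⟨y, hyU, hy⟩ := hδU
    have hδ : 0 < δ := hδ
    have hy0 : ∀ i, pairing (ℓ 0 i) y.1 < 0 := by
      intro i
      rw [hy, pairing_add, pairing_smul]
      have := mul_neg_of_pos_of_neg hδ (ho i)
      linarith [hp i]
    have hev' : ∀ᶠ t in 𝓝 (0 : ℝ), ∀ i, pairing (ℓ t i) y.1 < 0 := by
      rw [eventually_all]
      intro i
      have hc : Continuous fun t : ℝ => pairing (ℓ t i) y.1 :=
        (hcont i).comp (by fun_prop : Continuous fun t : ℝ => (t, y.1))
      exact hc.continuousAt.eventually_lt continuousAt_const (hy0 i)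
    exact (hev'.filter_mono nhdsWithin_le_nhds).mono fun t ht =>
      ⟨cls y, (cls_mem_iInter_halfSpace _).2 fun i => (ht i).le, hyU⟩

theorem continuous_rescaledWall (i : Idx) : Continuous fun t => rescaledWall t i := by
  refine continuous_pi fun j => ?_
  rcases i with e | e | l
  · exact continuous_const
  · fin_cases e <;> fin_cases j <;> simp [rescaledWall, rescaledMinus] <;> fun_prop
  · exact continuous_const

theorem convergesAtZero_rescaledPbar : ConvergesAtZero rescaledPbar := by
  rw [show rescaledPbar = fun t => ⋂ i, halfSpace (rescaledWall t i) from funext rescaledPbar_eq]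
  exact convergesAtZero_iInter_halfSpace continuous_rescaledWall
    (isGeneratedBy_vert (t := 0) (by norm_num) (by norm_num)).exists_neg

end TransitionPolytope

end

open TransitionPolytope in
theorem proposition6p2 :
    (∀ t ∈ Set.Ioc (-1 : ℝ) (1 / √3),
      -- the rescaled polytope is cut out by the 22 half-spaces, none of which is redundant
      rescaledPbar t = ⋂ i, halfSpace (rescaledWall t i) ∧
      (∀ i, ∃ p, p ∉ halfSpace (rescaledWall t i) ∧
        ∀ j, j ≠ i → p ∈ halfSpace (rescaledWall t j)) ∧
      -- it is a 4-polytope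
      IsPolytope (rescaledPbar t) ∧
      -- contained in the closure of the domain and in the affine chart
      rescaledPbar t ⊆ closure (X t) ∩ affineChart ∧
      -- it has 46 vertices, 12 of them ideal and the other 34 finite
      (vertices (rescaledPbar t)).ncard = 46 ∧
      (vertices (rescaledPbar t) ∩ frontier (X t)).ncard = 12 ∧
      (vertices (rescaledPbar t) ∩ X t).ncard = 34) ∧
    -- the combinatorics does not depend on the parameter
    (∀ t ∈ Set.Ioc (-1 : ℝ) (1 / √3), ∀ t' ∈ Set.Ioc (-1 : ℝ) (1 / √3),
      SameCombinatorics (rescaledPbar t) (rescaledPbar t')) ∧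
    -- the polytope at time 0 is the limit of the others
    ConvergesAtZero rescaledPbar := by
  refine ⟨fun t ht => ?_, fun t ht t' ht' => ?_, convergesAtZero_rescaledPbar⟩
  · obtain ⟨hs, hs'⟩ := mul_abs_mem_Ioc ht
    refine ⟨rescaledPbar_eq t, exists_not_mem_halfSpace hs hs', ?_, ?_, ncard_vertices hs hs',
      ncard_vertices_inter_frontier hs hs', ncard_vertices_inter_X hs hs'⟩
    · rw [rescaledPbar_eq]
      exact isPolytope_of_exists_neg (isGeneratedBy_vert hs hs').exists_neg
    · rw [rescaledPbar_eq]
      exact iInter_halfSpace_subset hs hs'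
  · obtain ⟨hs, hs'⟩ := mul_abs_mem_Ioc ht
    obtain ⟨hr, hr'⟩ := mul_abs_mem_Ioc ht'
    rw [rescaledPbar_eq, rescaledPbar_eq]
    exact (isGeneratedBy_vert hs hs').sameCombinatorics (isGeneratedBy_vert hr hr') fun i k => by
      rw [pairing_vert_eq_zero_iff hs hs', pairing_vert_eq_zero_iff hr hr']
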